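/- Let $0<h<1$, let $\lambda:=\lfloor 2/h\rfloor+1$, and let $L$ be an even integer with $L\ge 2\lambda$. Let $\Lambda=(\mathbb Z/L\mathbb Z)^2$ be the two-dimensional torus and $\mathcal S=\{-1,+1\}^{\Lambda}$. For $\sigma\in\mathcal S$ and $x\in\Lambda$ let $S_\sigma(x)$ be the sum of $\sigma(y)$ over the four nearest neighbours $y$ of $x$. For $\beta>0$ consider the probabilistic cellular automaton on $\mathcal S$ with transition probabilities $$p(\sigma,\eta)=\prod_{x\in\Lambda}\frac{1}{1+\exp\{-2\beta\,\eta(x)(S_\sigma(x)+h)\}},$$ which is reversible with respect to $e^{-\beta H}$, where $H(\sigma)=-h\sum_{x}\sigma(x)-\frac1\beta\sum_{x}\log\cosh[\beta(S_\sigma(x)+h)]$. Its zero-temperature energy and energy cost are $$E(\sigma)=\lim_{\beta\to\infty}H(\sigma)=-h\sum_{x\in\Lambda}\sigma(x)-\sum_{x\in\Lambda}|S_\sigma(x)+h|,$$ $$\Delta(\sigma,\eta)=-\lim_{\beta\to\infty}\frac{\log p(\sigma,\eta)}{\beta}=\sum_{x:\,\eta(x)(S_\sigma(x)+h)<0}2|S_\sigma(x)+h|,$$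 and the communication height is $E(\sigma,\eta)=E(\sigma)+\Delta(\sigma,\eta)$. A path is a finite sequence $\omega=(\omega_1,\dots,\omega_n)$, $n\ge1$, in $\mathcal S$; its height is $\Phi_\omega=E(\omega_1)$ if $n=1$ and $\Phi_\omega=\max_{1\le i<n}E(\omega_i,\omega_{i+1})$ otherwise. For $A\subset\mathcal S$ let $\Phi(\sigma,A)$ be the minimum of $\Phi_\omega$ over all paths from $\sigma$ to an element of $A$ ($+\infty$ if $A=\emptyset$). Let $\mathcal I_\sigma=\{\eta: E(\eta)<E(\sigma)\}$, let $V_\sigma=\Phi(\sigma,\mathcal I_\sigma)-E(\sigma)$ be the stability level of $\sigma$, let $X^{\mathrm s}$ be the set of global minima of $E$ (the ground states), let $\Gamma=\max_{\sigma\in\mathcal S\setminus X^{\mathrm s}}V_\sigma$ be the communication energy, and let $X^{\mathrm m}=\{\eta\in\mathcal S: V_\eta=\Gamma\}$ be the set of metastable states. Let $\mathbf u\equiv+1$, $\mathbf d\equiv-1$, and let $\mathbf c^{\mathrm e}(x)=(-1)^{x_1+x_2}$, $\mathbf c^{\mathrm o}(x)=(-1)^{x_1+x_2+1}$ be the two checkerboards.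 Then $$X^{\mathrm s}=\{\mathbf u\},\qquad X^{\mathrm m}=\{\mathbf d,\mathbf c^{\mathrm e},\mathbf c^{\mathrm o}\},\qquad E(\mathbf d)>E(\mathbf c^{\mathrm e})=E(\mathbf c^{\mathrm o}),$$ and $\Gamma>0$ with $$\Gamma=\Gamma_{\mathrm m}:=-2h\lambda^2+2(4+h)\lambda-2h .$$ -/

import Mathlib

namespace PCA

/-- The two-dimensional torus of side `L`. -/
abbrev Site (L : ℕ) : Type := ZMod L × ZMod L

/-- Spin configurations; `ℤˣ` is the set `{-1, +1}`. -/
abbrev Config (L : ℕ) : Type := Site L → ℤˣ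

/-- The spin `σ(x) ∈ {-1, +1}` as a real number. -/
def spin {L : ℕ} (σ : Config L) (x : Site L) : ℝ := ((σ x : ℤ) : ℝ)

/-- The nearest-neighbour kernel: `K z = 1` if `z` is at distance one from the origin of the
torus, and `K z = 0` otherwise. -/
def K {L : ℕ} (z : Site L) : ℝ :=
  if z = (1, 0) ∨ z = (-1, 0) ∨ z = (0, 1) ∨ z = (0, -1) then 1 else 0

noncomputable section

/-! ### The chain at inverse temperature `β` and field `h` -/

/-- `S_σ(x) = ∑_y K(x - y) σ(y)`. -/
def S {L : ℕ} [NeZero L] (σ : Config L) (x : Site L) : ℝ :=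
  ∑ y : Site L, K (x - y) * spin σ y

/-- The one-site updating rule `p_{x,σ}(s)`. -/
def siteProb {L : ℕ} [NeZero L] (β h : ℝ) (x : Site L) (σ : Config L) (s : ℤˣ) : ℝ :=
  1 / (1 + Real.exp (-2 * β * ((s : ℤ) : ℝ) * (S σ x + h)))

/-- The transition matrix `p(σ, η)` of the PCA. -/
def transProb {L : ℕ} [NeZero L] (β h : ℝ) (σ η : Config L) : ℝ :=
  ∏ x : Site L, siteProb β h x σ (η x)

/-- The Hamiltonian `H(σ)`, with respect to which the PCA is reversible. -/
def hamiltonian {L : ℕ} [NeZero L] (β h : ℝ) (σ : Config L) : ℝ :=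
  -h * ∑ x : Site L, spin σ x
    - 1 / β * ∑ x : Site L, Real.log (Real.cosh (β * (S σ x + h)))

/-! ### The zero-temperature energy landscape -/

/-- The energy `E(σ)`, the limit of `H(σ)` as `β → ∞` (see `tendsto_hamiltonian`). -/
def energy {L : ℕ} [NeZero L] (h : ℝ) (σ : Config L) : ℝ :=
  -h * ∑ x : Site L, spin σ x - ∑ x : Site L, |S σ x + h|

/-- The energy cost `Δ(σ, η)`, the limit of `-(log p(σ, η)) / β` as `β → ∞`
(see `tendsto_transProb`). -/
def cost {L : ℕ} [NeZero L] (h : ℝ) (σ η : Config L) : ℝ :=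
  ∑ x : Site L with spin η x * (S σ x + h) < 0, 2 * |S σ x + h|

/-- The communication height `E(σ, η) = E(σ) + Δ(σ, η)`, the limit of
`H(σ, η) = H(σ) - (log p(σ, η)) / β` as `β → ∞`. -/
def commHeight {L : ℕ} [NeZero L] (h : ℝ) (σ η : Config L) : ℝ :=
  energy h σ + cost h σ η

/-- The height `Φ_ω` along a path `ω = (ω 0, …, ω n)`. -/
def height {L : ℕ} [NeZero L] (h : ℝ) : (n : ℕ) → (Fin (n + 1) → Config L) → ℝ
  | 0, ω => energy h (ω 0)
  | n + 1, ω => Finset.univ.sup' ⟨(0 : Fin (n + 1)), Finset.mem_univ _⟩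
      (fun i : Fin (n + 1) => commHeight h (ω i.castSucc) (ω i.succ))

/-- The minimax `Φ(σ, η)`: the least height of a path from `σ` to `η`. -/
def minimax {L : ℕ} [NeZero L] (h : ℝ) (σ η : Config L) : EReal :=
  ⨅ (n : ℕ) (ω : Fin (n + 1) → Config L) (_ : ω 0 = σ) (_ : ω (Fin.last n) = η),
    ((height h n ω : ℝ) : EReal)

/-- `Φ(σ, A)`: the least height of a path from `σ` to the set `A` (`⊤` if `A` is empty). -/
def minimaxSet {L : ℕ} [NeZero L] (h : ℝ) (σ : Config L) (A : Set (Config L)) : EReal :=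
  ⨅ η ∈ A, minimax h σ η

/-- `I_σ`: the configurations with energy strictly below that of `σ`. -/
def lowerSet {L : ℕ} [NeZero L] (h : ℝ) (σ : Config L) : Set (Config L) :=
  {η | energy h η < energy h σ}

/-- The stability level `V_σ = Φ(σ, I_σ) - E(σ)`; it is `⊤` when `I_σ` is empty, that is,
when `σ` is a ground state. -/
def stabilityLevel {L : ℕ} [NeZero L] (h : ℝ) (σ : Config L) : EReal :=
  minimaxSet h σ (lowerSet h σ) - ((energy h σ : ℝ) : EReal)

/-- `X^s`: the ground states, i.e. the global minima of the energy. -/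
def groundStates (L : ℕ) [NeZero L] (h : ℝ) : Set (Config L) :=
  {σ | ∀ η : Config L, energy h σ ≤ energy h η}

/-- The communication energy `Γ = max_{σ ∉ X^s} V_σ`. -/
def commEnergy (L : ℕ) [NeZero L] (h : ℝ) : EReal :=
  ⨆ σ ∈ (groundStates L h)ᶜ, stabilityLevel h σ

/-- `X^m`: the metastable states, those with `V_η = Γ`. -/
def metastableStates (L : ℕ) [NeZero L] (h : ℝ) : Set (Config L) :=
  {η | stabilityLevel h η = commEnergy L h}

/-! ### The special configurations and the activation energy -/

/-- The configuration `u`: all spins plus. -/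
def allPlus (L : ℕ) : Config L := fun _ => 1

/-- The configuration `d`: all spins minus. -/
def allMinus (L : ℕ) : Config L := fun _ => -1

/-- The checkerboard `c^e` with pluses on the even sublattice, `c^e(x) = (-1)^(x₁ + x₂)`. -/
def checkerEven (L : ℕ) : Config L := fun x => (-1) ^ (x.1.val + x.2.val)

/-- The checkerboard `c^o` with pluses on the odd sublattice, `c^o(x) = (-1)^(x₁ + x₂ + 1)`. -/
def checkerOdd (L : ℕ) : Config L := fun x => (-1) ^ (x.1.val + x.2.val + 1)

/-- The critical length `λ = ⌊2/h⌋ + 1`. -/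
def critLength (h : ℝ) : ℕ := ⌊2 / h⌋₊ + 1

/-- The activation energy `Γ_m = -2hλ² + 2(4 + h)λ - 2h`. -/
def activationEnergy (h : ℝ) : ℝ :=
  -2 * h * (critLength h : ℝ) ^ 2 + 2 * (4 + h) * (critLength h : ℝ) - 2 * h

/-! ### `energy` and `cost` are the zero-temperature limits -/

open Filter Topology in
theorem tendsto_log_cosh (a : ℝ) :
    Tendsto (fun β : ℝ => 1 / β * Real.log (Real.cosh (β * a))) atTop (𝓝 |a|) := by
  have h0 : Tendsto (fun β : ℝ => |a| - Real.log 2 * β⁻¹) atTop (𝓝 |a|) := by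
    simpa using (tendsto_const_nhds (x := |a|)).sub
      ((tendsto_inv_atTop_zero (𝕜 := ℝ)).const_mul (Real.log 2))
  refine tendsto_of_tendsto_of_tendsto_of_le_of_le' h0 tendsto_const_nhds ?_ ?_
  all_goals
    filter_upwards [eventually_gt_atTop (0 : ℝ)] with β hβ
    have hc : Real.cosh (β * a) = (Real.exp (β * |a|) + Real.exp (-(β * |a|))) / 2 := by
      rw [← Real.cosh_eq, ← Real.cosh_abs (β * a), abs_mul, abs_of_pos hβ]
    have hp : 0 ≤ β * |a| := by positivity
  · have : β * |a| - Real.log 2 ≤ Real.log (Real.cosh (β * a)) := by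
      rw [Real.le_log_iff_exp_le (Real.cosh_pos _), Real.exp_sub, Real.exp_log two_pos, hc]
      have := Real.exp_pos (-(β * |a|))
      linarith
    calc |a| - Real.log 2 * β⁻¹ = 1 / β * (β * |a| - Real.log 2) := by field_simp
      _ ≤ _ := by gcongr
  · have : Real.log (Real.cosh (β * a)) ≤ β * |a| := by
      rw [Real.log_le_iff_le_exp (Real.cosh_pos _), hc]
      have := Real.exp_le_exp.2 (by linarith : -(β * |a|) ≤ β * |a|)
      linarith
    calc _ ≤ 1 / β * (β * |a|) := by gcongr
      _ = |a| := by field_simp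

open Filter Topology in
theorem tendsto_hamiltonian {L : ℕ} [NeZero L] (h : ℝ) (σ : Config L) :
    Tendsto (fun β : ℝ => hamiltonian β h σ) atTop (𝓝 (energy h σ)) := by
  unfold hamiltonian energy
  refine tendsto_const_nhds.sub ?_
  simp only [Finset.mul_sum]
  exact tendsto_finsetSum _ fun x _ => tendsto_log_cosh _

open Filter Topology in
theorem tendsto_transProb {L : ℕ} [NeZero L] (h : ℝ) (σ η : Config L) :
    Tendsto (fun β : ℝ => -(Real.log (transProb β h σ η) / β)) atTop (𝓝 (cost h σ η)) := by
  have key : ∀ b : ℝ, Tendsto (fun β : ℝ => -(Real.log (1 / (1 + Real.exp (-2 * β * b))) / β))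
      atTop (𝓝 (if b < 0 then 2 * |b| else 0)) := by
    intro b
    have e : (if b < 0 then 2 * |b| else 0) = -b + |b| := by
      split_ifs with hb
      · rw [abs_of_neg hb]; ring
      · rw [abs_of_nonneg (not_lt.1 hb)]; ring
    rw [e]
    have h0 : Tendsto (fun β : ℝ => Real.log 2 * β⁻¹ + (-b + 1 / β * Real.log (Real.cosh (β * b))))
        atTop (𝓝 (-b + |b|)) := by
      simpa using ((tendsto_inv_atTop_zero (𝕜 := ℝ)).const_mul (Real.log 2)).add
        ((tendsto_log_cosh b).const_add (-b))
    refine h0.congr' ?_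
    filter_upwards [eventually_gt_atTop (0 : ℝ)] with β hβ
    have : 1 + Real.exp (-2 * β * b) = 2 * Real.exp (-(β * b)) * Real.cosh (β * b) := by
      rw [Real.cosh_eq]
      have h1 : Real.exp (-(β * b)) * Real.exp (β * b) = 1 := by
        rw [← Real.exp_add]; simp
      have h2 : Real.exp (-2 * β * b) = Real.exp (-(β * b)) * Real.exp (-(β * b)) := by
        rw [← Real.exp_add]; ring_nf
      rw [h2]; linear_combination -h1
    rw [one_div (1 + _), Real.log_inv, this, Real.log_mul (by positivity) (Real.cosh_pos _).ne',
      Real.log_mul two_ne_zero (Real.exp_pos _).ne', Real.log_exp]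
    field_simp
    ring
  have habs : ∀ x, |spin η x| = 1 := by
    intro x
    rcases Int.units_eq_one_or (η x) with hx | hx <;> simp [spin, hx]
  have hsum : ∀ β : ℝ, -(Real.log (transProb β h σ η) / β) = ∑ x : Site L,
      -(Real.log (1 / (1 + Real.exp (-2 * β * (spin η x * (S σ x + h))))) / β) := by
    intro β
    unfold transProb siteProb
    rw [Real.log_prod (fun x _ => by positivity), Finset.sum_div, ← Finset.sum_neg_distrib]
    simp only [spin, mul_assoc]
  simp only [hsum]
  unfold cost
  rw [Finset.sum_filter]
  refine tendsto_finsetSum _ fun x _ => ?_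
  have := key (spin η x * (S σ x + h))
  rwa [abs_mul, habs, one_mul] at this

end

end PCA

namespace PCA

noncomputable section

/-! ### The two sublattices and the Ising energy -/

/-! For `L` even and at least 6 the torus is bipartite: the local field at a site sees only spins of
the opposite parity. Let `mix p σ η` be `σ` on one sublattice and `η` on the other. Aligned updates
are free and a misaligned one costs twice the local field, so the height of a step is the sum of the
Ising energies of the two interlaced configurations, `ising (mix p σ η) + ising (mix (p + 1) σ η)`
(`commHeight_eq`). Likewise `energy` is the sum of two half energies, each the least Ising energy
over completions of one half of `σ` (`energy_eq`, `halfEnergy_le`). A path of the automaton is thus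
a pair of Ising trajectories, each updating the sublattices alternately, and the problem becomes
nucleation for the Ising model.

Lower bounds. An isoperimetric inequality gives every configuration with `critCount` pluses an Ising
energy at least `activationEnergy` above all minus (`activationEnergy_le`), and none with fewer
pluses lies below all minus. Updating a whole sublattice cannot jump this barrier, since two
configurations differing on one sublattice are joined by single flips below the larger of their
energies (`exists_plusCount_eq`). From all minus both trajectories are trapped; from a checkerboard
one is trapped while the other already has the minimal energy. Both cases give stability level at
least `activationEnergy`.

Upper bounds. An Ising chain that descends from a completed half lifts to a path of the automaton,
with the other half only relaxing (`stabilityLevel_lt_of_hasDescent`). From a minus half the chain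
grows nearly square droplets, whose energy never exceeds `activationEnergy`. If a half is not
constant, the droplet is grown across an existing interface, and submodularity saves at least the
energy `8 - 2h` of a single plus, so the stability level is strictly smaller. The only
configurations with two constant halves are all plus, all minus and the two checkerboards. -/

theorem spin_cases {L : ℕ} (σ : Config L) (x : Site L) :
    (σ x = 1 ∧ spin σ x = 1) ∨ (σ x = -1 ∧ spin σ x = -1) := by
  rcases Int.units_eq_one_or (σ x) with hx | hx <;> simp [spin, hx]

/-- The parity of a site. -/
def par {L : ℕ} (x : Site L) : ZMod 2 := ((x.1.val + x.2.val : ℕ) : ZMod 2)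

theorem par_add {L : ℕ} [NeZero L] (hL : Even L) (x y : Site L) :
    par (x + y) = par x + par y := by
  have key : ∀ n : ℕ, ((n % L : ℕ) : ZMod 2) = n := fun n => by
    rw [ZMod.natCast_eq_natCast_iff', Nat.mod_mod_of_dvd _ hL.two_dvd]
  simp only [par, Prod.fst_add, Prod.snd_add, ZMod.val_add, Nat.cast_add, key]
  ring

theorem par_unit {L : ℕ} [NeZero L] (hL : Even L) (h2 : 2 < L) {z : Site L}
    (hz : K z ≠ 0) : par z = 1 := by
  have : Fact (1 < L) := ⟨by omega⟩
  have h0 : par (0 : Site L) = 0 := by simp [par]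
  have hneg : ∀ w : Site L, par w = 1 → par (-w) = 1 := fun w hw => by
    have := par_add hL w (-w)
    rw [add_neg_cancel, h0, hw] at this
    generalize par (-w) = a at this ⊢
    revert a; decide
  have ha : par ((1, 0) : Site L) = 1 := by simp [par, ZMod.val_one]
  have hb : par ((0, 1) : Site L) = 1 := by simp [par, ZMod.val_one]
  unfold K at hz
  split_ifs at hz with hc
  · rcases hc with rfl | rfl | rfl | rfl
    · exact ha
    · simpa using hneg _ ha
    · exact hb
    · simpa using hneg _ hb
  · simp at hz

theorem zmod_two_ne {a p : ZMod 2} : a ≠ p ↔ a = p + 1 := by revert a p; decide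

theorem zmod_two_ne_add_one {a p : ZMod 2} : a ≠ p + 1 ↔ a = p := by revert a p; decide

theorem par_of_K {L : ℕ} [NeZero L] (hL : Even L) (h2 : 2 < L) {x y : Site L}
    (hz : K (x - y) ≠ 0) : par x = par y + 1 := by
  have := par_add hL y (x - y)
  rw [add_sub_cancel] at this
  rw [this, par_unit hL h2 hz]

theorem K_nonneg {L : ℕ} (z : Site L) : 0 ≤ K z := by
  unfold K; split_ifs <;> norm_num

theorem K_neg {L : ℕ} (z : Site L) : K (-z) = K z := by
  unfold K
  congr 1
  simp only [neg_eq_iff_eq_neg, Prod.neg_mk, neg_neg, neg_zero, eq_iff_iff]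
  tauto

theorem K_sub_comm {L : ℕ} (x y : Site L) : K (x - y) = K (y - x) := by
  rw [← K_neg, neg_sub]

theorem S_eq {L : ℕ} [NeZero L] (h2 : 2 < L) (σ : Config L) (x : Site L) :
    S σ x = spin σ (x + (1, 0)) + spin σ (x - (1, 0)) + spin σ (x + (0, 1))
      + spin σ (x - (0, 1)) := by
  have : Fact (2 < L) := ⟨h2⟩
  have : Fact (1 < L) := ⟨by omega⟩
  have hne : (1 : ZMod L) ≠ -1 := (ZMod.neg_one_ne_one (n := L)).symm
  have h10 : (1 : ZMod L) ≠ 0 := one_ne_zero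
  have hK : ∀ z : Site L, K z = (if z = (1, 0) then 1 else 0) + (if z = -(1, 0) then 1 else 0)
      + (if z = (0, 1) then 1 else 0) + (if z = -(0, 1) then 1 else (0 : ℝ)) := by
    intro z
    unfold K
    by_cases a : z = (1, 0)
    · subst a; simp [hne, h10]
    by_cases b : z = -(1, 0)
    · subst b; simp [h10, hne.symm, h10.symm]
    by_cases c : z = (0, 1)
    · subst c; simp [hne, h10, h10.symm]
    by_cases d : z = -(0, 1)
    · subst d; simp [h10, hne.symm, h10.symm]
    have b' : z ≠ (-1, 0) := by simpa using b
    have d' : z ≠ (0, -1) := by simpa using d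
    simp [a, c, b', d']
  unfold S
  rw [← (Equiv.subLeft x).sum_comp]
  simp only [Equiv.subLeft_apply, sub_sub_cancel, hK, add_mul, Finset.sum_add_distrib, ite_mul,
    one_mul, zero_mul, Finset.sum_ite_eq', Finset.mem_univ, if_true,
    sub_neg_eq_add]
  ring

/-- The Ising energy with coupling one and field `h`. -/
def ising {L : ℕ} [NeZero L] (h : ℝ) (s : Config L) : ℝ :=
  -h * ∑ x : Site L, spin s x - 1 / 2 * ∑ x : Site L, spin s x * S s x

/-- The configuration equal to `σ` on the sublattice of parity `p` and to `η` on the other one. -/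
def mix {L : ℕ} (p : ZMod 2) (σ η : Config L) : Config L :=
  fun x => if par x = p then σ x else η x

theorem mix_comm {L : ℕ} (p : ZMod 2) (σ η : Config L) : mix (p + 1) σ η = mix p η σ := by
  funext x
  unfold mix
  by_cases hx : par x = p
  · simp [hx]
  · simp [zmod_two_ne.1 hx]

theorem mix_self {L : ℕ} (p : ZMod 2) (σ : Config L) : mix p σ σ = σ := by
  funext x; simp [mix]

theorem spin_mix_of {L : ℕ} {p : ZMod 2} {x : Site L} (hx : par x = p) (σ η : Config L) :
    spin (mix p σ η) x = spin σ x := by simp [spin, mix, hx]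

theorem spin_mix_of_ne {L : ℕ} {p : ZMod 2} {x : Site L} (hx : par x ≠ p) (σ η : Config L) :
    spin (mix p σ η) x = spin η x := by simp [spin, mix, hx]

theorem S_congr {L : ℕ} [NeZero L] (hL : Even L) (h2 : 2 < L) {σ η : Config L} {x : Site L}
    (hx : ∀ y, par y ≠ par x → σ y = η y) : S σ x = S η x := by
  refine Finset.sum_congr rfl fun y _ => ?_
  by_cases hK : K (x - y) = 0
  · simp [hK]
  · have := par_of_K hL h2 hK
    rw [spin, spin, hx y]
    intro hc
    exact zmod_two_ne.2 this hc.symm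

/-- Once one sublattice is frozen the spins on the other do not interact: each sits alone in the
field `S σ x + h`. -/
theorem ising_mix {L : ℕ} [NeZero L] (hL : Even L) (h2 : 2 < L) (h : ℝ) (p : ZMod 2)
    (σ η : Config L) :
    ising h (mix p σ η) = -h * ∑ x : Site L with par x = p, spin σ x
      - ∑ x : Site L with par x ≠ p, spin η x * (S σ x + h) := by
  set m := mix p σ η with hm
  have hS : ∀ x : Site L, par x ≠ p → S m x = S σ x := fun x hx =>
    S_congr hL h2 fun y hy => by
      have : par y = p := by
        by_contra hc
        exact hy (by rw [zmod_two_ne.1 hc, zmod_two_ne.1 hx])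
      simp [hm, mix, this]
  -- Every bond joins the two sublattices, so summing over bonds from either end gives the same
  -- value; this absorbs the factor `1 / 2` in `ising`.
  have hswap : ∑ x : Site L with par x = p, spin m x * S m x
      = ∑ x : Site L with par x ≠ p, spin m x * S m x := by
    have e : ∀ q : ZMod 2, ∀ x : Site L, par x = q →
        S m x = ∑ y : Site L with par y ≠ q, K (x - y) * spin m y := by
      intro q x hx
      unfold S
      symm
      refine Finset.sum_subset (Finset.subset_univ _) fun y _ hy => ?_
      have hy' : par y = q := by simpa using hy
      have : K (x - y) = 0 := by
        by_contra hK
        have := zmod_two_ne.2 (par_of_K hL h2 hK)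
        exact this (by rw [hx, hy'])
      simp [this]
    have e2 : ∀ x : Site L, par x ≠ p →
        S m x = ∑ y : Site L with par y = p, K (x - y) * spin m y := by
      intro x hx
      rw [e (p + 1) x (zmod_two_ne.1 hx)]
      refine Finset.sum_congr (Finset.filter_congr fun y _ => zmod_two_ne_add_one)
        fun _ _ => rfl
    rw [Finset.sum_congr rfl fun x hx => by
        rw [e p x (Finset.mem_filter.1 hx).2, Finset.mul_sum],
      Finset.sum_comm]
    refine Finset.sum_congr rfl fun y hy => ?_
    rw [e2 y (Finset.mem_filter.1 hy).2, Finset.mul_sum]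
    refine Finset.sum_congr rfl fun x _ => ?_
    rw [K_sub_comm]; ring
  have s1 := Finset.sum_filter_add_sum_filter_not Finset.univ (fun x : Site L => par x = p)
    (fun x => spin m x * S m x)
  have s2 := Finset.sum_filter_add_sum_filter_not Finset.univ (fun x : Site L => par x = p)
    (fun x => spin m x)
  have c1 : ∑ x : Site L with par x = p, spin m x = ∑ x : Site L with par x = p, spin σ x :=
    Finset.sum_congr rfl fun x hx => spin_mix_of (Finset.mem_filter.1 hx).2 _ _
  have c2 : ∑ x : Site L with par x ≠ p, spin m x = ∑ x : Site L with par x ≠ p, spin η x :=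
    Finset.sum_congr rfl fun x hx => spin_mix_of_ne (Finset.mem_filter.1 hx).2 _ _
  have c3 : ∑ x : Site L with par x ≠ p, spin m x * S m x
      = ∑ x : Site L with par x ≠ p, spin η x * S σ x :=
    Finset.sum_congr rfl fun x hx => by
      rw [hS x (Finset.mem_filter.1 hx).2, hm, spin_mix_of_ne (Finset.mem_filter.1 hx).2]
  have c4 : ∑ x : Site L with par x ≠ p, spin η x * (S σ x + h)
      = ∑ x : Site L with par x ≠ p, spin η x * S σ x
        + h * ∑ x : Site L with par x ≠ p, spin η x := by
    rw [Finset.mul_sum, ← Finset.sum_add_distrib]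
    exact Finset.sum_congr rfl fun x _ => by ring
  unfold ising
  simp only [ne_eq] at *
  rw [← s1, ← s2, hswap, c1, c2, c3, c4]
  ring

/-- Flipping one spin. -/
theorem ising_flip {L : ℕ} [NeZero L] (hL : Even L) (h2 : 2 < L) (h : ℝ) (s : Config L)
    (x : Site L) :
    ising h (Function.update s x (-s x)) = ising h s + 2 * spin s x * (S s x + h) := by
  have hx : par x ≠ par x + 1 := zmod_two_ne.2 (by generalize par x = a; revert a; decide)
  have e : Function.update s x (-s x) = mix (par x + 1) s (Function.update s x (-s x)) := by
    funext y
    unfold mix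
    split_ifs with hy
    · rw [Function.update_of_ne]
      rintro rfl
      exact hx hy
    · rfl
  have e' : s = mix (par x + 1) s s := (mix_self _ _).symm
  conv_lhs => rw [e]
  conv_rhs => enter [1]; rw [e']
  rw [ising_mix hL h2, ising_mix hL h2]
  have hmem : x ∈ Finset.univ.filter fun y : Site L => par y ≠ par x + 1 := by simp
  rw [← Finset.add_sum_erase _ _ hmem, ← Finset.add_sum_erase _ (fun y => spin s y * _) hmem]
  have : ∀ y ∈ (Finset.univ.filter fun y : Site L => par y ≠ par x + 1).erase x,
      spin (Function.update s x (-s x)) y * (S s y + h) = spin s y * (S s y + h) := by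
    intro y hy
    simp [spin, Function.update_of_ne (Finset.ne_of_mem_erase hy)]
  rw [Finset.sum_congr rfl this]
  simp [spin]
  ring

/-- The join of two configurations. -/
def join {L : ℕ} (s t : Config L) : Config L := fun x => if t x = 1 then 1 else s x

/-- The meet of two configurations. -/
def meet {L : ℕ} (s t : Config L) : Config L := fun x => if t x = 1 then s x else -1

/-- Submodularity of the Ising energy. -/
theorem ising_join_add_meet {L : ℕ} [NeZero L] (h : ℝ) (s t : Config L) :
    ising h (join s t) + ising h (meet s t) ≤ ising h s + ising h t := by
  have m : ∀ x, spin (join s t) x + spin (meet s t) x = spin s x + spin t x := by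
    intro x
    rcases Int.units_eq_one_or (s x) with a | a <;> rcases Int.units_eq_one_or (t x) with b | b <;>
      simp [spin, join, meet, a, b]
  have hB : ∀ x y, spin s x * spin s y + spin t x * spin t y ≤
      spin (join s t) x * spin (join s t) y + spin (meet s t) x * spin (meet s t) y := by
    intro x y
    rcases Int.units_eq_one_or (s x) with a | a <;> rcases Int.units_eq_one_or (t x) with b | b <;>
    rcases Int.units_eq_one_or (s y) with c | c <;> rcases Int.units_eq_one_or (t y) with d | d <;>
      simp [spin, join, meet, a, b, c, d] <;> norm_num
  have e1 : ∑ x, spin (join s t) x + ∑ x, spin (meet s t) x = ∑ x, spin s x + ∑ x, spin t x := by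
    rw [← Finset.sum_add_distrib, ← Finset.sum_add_distrib]
    exact Finset.sum_congr rfl fun x _ => m x
  have e2 : ∑ x, spin s x * S s x + ∑ x, spin t x * S t x
      ≤ ∑ x, spin (join s t) x * S (join s t) x + ∑ x, spin (meet s t) x * S (meet s t) x := by
    simp only [S, Finset.mul_sum, ← Finset.sum_add_distrib]
    refine Finset.sum_le_sum fun x _ => Finset.sum_le_sum fun y _ => ?_
    have := mul_le_mul_of_nonneg_left (hB x y) (K_nonneg (x - y))
    linarith
  have e3 : h * ∑ x, spin (join s t) x + h * ∑ x, spin (meet s t) x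
      = h * ∑ x, spin s x + h * ∑ x, spin t x := by rw [← mul_add, e1, mul_add]
  unfold ising
  linarith

/-! ### The energy landscape in terms of the Ising energy -/

/-- The zero-temperature update of `σ`. -/
def follow {L : ℕ} [NeZero L] (h : ℝ) (σ : Config L) : Config L :=
  fun x => if 0 ≤ S σ x + h then 1 else -1

/-- The energy carried by the half of `σ` on the sublattice of parity `p`. -/
def halfEnergy {L : ℕ} [NeZero L] (h : ℝ) (p : ZMod 2) (σ : Config L) : ℝ :=
  ising h (mix p σ (follow h σ))

theorem spin_follow {L : ℕ} [NeZero L] (h : ℝ) (σ : Config L) (x : Site L) :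
    spin (follow h σ) x * (S σ x + h) = |S σ x + h| := by
  unfold spin follow
  split_ifs with hx
  · simp [abs_of_nonneg hx]
  · simp [abs_of_neg (not_le.1 hx)]

/-- `follow` aligns each free spin with its local field, hence minimises every term of `ising_mix`
separately. -/
theorem halfEnergy_le {L : ℕ} [NeZero L] (hL : Even L) (h2 : 2 < L) (h : ℝ) (p : ZMod 2)
    (σ η : Config L) : halfEnergy h p σ ≤ ising h (mix p σ η) := by
  unfold halfEnergy
  rw [ising_mix hL h2, ising_mix hL h2]
  refine sub_le_sub_left (Finset.sum_le_sum fun x _ => ?_) _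
  rw [spin_follow]
  rcases spin_cases η x with ⟨-, hx⟩ | ⟨-, hx⟩ <;> rw [hx]
  · rw [one_mul]; exact le_abs_self _
  · rw [neg_one_mul]; exact neg_le_abs _

theorem sum_filter_par {L : ℕ} [NeZero L] (p : ZMod 2) (f : Site L → ℝ) :
    ∑ x : Site L with par x = p, f x + ∑ x : Site L with par x = p + 1, f x = ∑ x, f x := by
  rw [← Finset.sum_filter_add_sum_filter_not Finset.univ (fun x : Site L => par x = p)]
  congr 1
  exact Finset.sum_congr (Finset.filter_congr fun x _ => zmod_two_ne.symm) fun _ _ => rfl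

theorem ising_mix_add {L : ℕ} [NeZero L] (hL : Even L) (h2 : 2 < L) (h : ℝ) (p : ZMod 2)
    (σ η : Config L) : ising h (mix p σ η) + ising h (mix (p + 1) σ η)
      = -h * ∑ x, spin σ x - ∑ x, spin η x * (S σ x + h) := by
  rw [ising_mix hL h2, ising_mix hL h2, ← sum_filter_par p (spin σ), ← sum_filter_par p]
  have e1 : (Finset.univ.filter fun x : Site L => par x ≠ p)
      = Finset.univ.filter fun x : Site L => par x = p + 1 :=
    Finset.filter_congr fun x _ => zmod_two_ne
  have e2 : (Finset.univ.filter fun x : Site L => par x ≠ p + 1)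
      = Finset.univ.filter fun x : Site L => par x = p :=
    Finset.filter_congr fun x _ => zmod_two_ne_add_one
  rw [e1, e2]
  ring

/-- Site by site, the cost `2 |S σ x + h|` of a misaligned update turns `-|S σ x + h|` into `-η(x)
(S σ x + h)`. This splits the automaton into two Ising trajectories. -/
theorem commHeight_eq {L : ℕ} [NeZero L] (hL : Even L) (h2 : 2 < L) (h : ℝ) (p : ZMod 2)
    (σ η : Config L) :
    commHeight h σ η = ising h (mix p σ η) + ising h (mix (p + 1) σ η) := by
  rw [ising_mix_add hL h2]
  unfold commHeight energy cost
  rw [Finset.sum_filter, sub_add, ← Finset.sum_sub_distrib]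
  congr 1
  refine Finset.sum_congr rfl fun x _ => ?_
  rcases spin_cases η x with ⟨-, hx⟩ | ⟨-, hx⟩ <;> rw [hx] <;> split_ifs with hc
  · rw [abs_of_neg (by linarith)]; ring
  · rw [abs_of_nonneg (by linarith)]; ring
  · rw [abs_of_pos (by linarith)]; ring
  · rw [abs_of_nonpos (by linarith)]; ring

theorem energy_eq {L : ℕ} [NeZero L] (hL : Even L) (h2 : 2 < L) (h : ℝ) (p : ZMod 2)
    (σ : Config L) : energy h σ = halfEnergy h p σ + halfEnergy h (p + 1) σ := by
  unfold halfEnergy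
  rw [ising_mix_add hL h2]
  simp only [spin_follow, energy]

/-! ### All plus as the unique minimum of the Ising energy -/

theorem spin_le_one {L : ℕ} (σ : Config L) (x : Site L) : spin σ x ≤ 1 := by
  rcases spin_cases σ x with ⟨-, hx⟩ | ⟨-, hx⟩ <;> rw [hx]; norm_num

theorem neg_one_le_spin {L : ℕ} (σ : Config L) (x : Site L) : -1 ≤ spin σ x := by
  rcases spin_cases σ x with ⟨-, hx⟩ | ⟨-, hx⟩ <;> rw [hx]; norm_num

theorem ising_allPlus_le {L : ℕ} [NeZero L] {h : ℝ} (s : Config L) :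
    ising h (allPlus L) + h * ∑ x : Site L, (1 - spin s x) ≤ ising h s := by
  have e : ∑ x, spin s x * S s x ≤ ∑ x, spin (allPlus L) x * S (allPlus L) x := by
    simp only [S, Finset.mul_sum]
    refine Finset.sum_le_sum fun x _ => Finset.sum_le_sum fun y _ => ?_
    have hK := K_nonneg (x - y)
    have h1 : spin (allPlus L) x = 1 := by simp [spin, allPlus]
    have h1' : spin (allPlus L) y = 1 := by simp [spin, allPlus]
    rw [h1, h1']
    rcases spin_cases s x with ⟨-, hx⟩ | ⟨-, hx⟩ <;> rcases spin_cases s y with ⟨-, hy⟩ | ⟨-, hy⟩ <;>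
      rw [hx, hy] <;> linarith
  have e1 : ∑ x, spin (allPlus L) x = ∑ x : Site L, (1 : ℝ) := by simp [spin, allPlus]
  unfold ising
  rw [Finset.sum_sub_distrib, e1]
  linarith

theorem ising_allPlus_le_ising {L : ℕ} [NeZero L] {h : ℝ} (h_pos : 0 < h) (s : Config L) :
    ising h (allPlus L) ≤ ising h s := by
  have := ising_allPlus_le (h := h) s
  have h0 : 0 ≤ ∑ x : Site L, (1 - spin s x) :=
    Finset.sum_nonneg fun x _ => sub_nonneg.2 (spin_le_one s x)
  nlinarith [mul_nonneg h_pos.le h0]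

theorem ising_allPlus_lt_ising {L : ℕ} [NeZero L] {h : ℝ} (h_pos : 0 < h) {s : Config L}
    (hs : s ≠ allPlus L) : ising h (allPlus L) < ising h s := by
  have := ising_allPlus_le (h := h) s
  obtain ⟨x, hx⟩ := Function.ne_iff.1 hs
  have h0 : 0 < ∑ x : Site L, (1 - spin s x) := by
    refine Finset.sum_pos' (fun x _ => sub_nonneg.2 (spin_le_one s x)) ⟨x, Finset.mem_univ _, ?_⟩
    rcases spin_cases s x with ⟨h1, -⟩ | ⟨-, h1⟩
    · exact absurd h1 hx
    · rw [h1]; norm_num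
  nlinarith [mul_pos h_pos h0]

/-! ### Isoperimetry on the torus -/

theorem exists_step {L : ℕ} [NeZero L] {f : ZMod L → ℤˣ} {a : ℤˣ} {i j : ZMod L}
    (hi : f i = a) (hj : f j = -a) : ∃ k, f k = a ∧ f (k + 1) = -a := by
  by_contra! hc
  have hstep : ∀ k, f k = a → f (k + 1) = a := fun k hk => by
    have := hc k hk
    rcases Int.units_eq_one_or (f (k + 1)) with h1 | h1 <;>
      rcases Int.units_eq_one_or a with h2 | h2 <;> simp_all
  have hall : ∀ n : ℕ, f (i + n) = a := by
    intro n
    induction n with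
    | zero => simpa using hi
    | succ n ih => rw [Nat.cast_add, ← add_assoc]; simpa using hstep _ ih
  have := hall (j - i).val
  rw [ZMod.natCast_zmod_val, add_sub_cancel, hj] at this
  exact absurd this (by rcases Int.units_eq_one_or a with rfl | rfl <;> decide)

/-- A cycle that leaves the value `1` must also return to it: two sign changes, each contributing 2.
-/
theorem four_le_sum_cyclic {L : ℕ} [NeZero L] {f : ZMod L → ℤˣ} {i j : ZMod L}
    (hi : f i = 1) (hj : f j = -1) :
    (4 : ℝ) ≤ ∑ k, (1 - ((f k : ℤ) : ℝ) * ((f (k + 1) : ℤ) : ℝ)) := by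
  obtain ⟨k, hk, hk'⟩ := exists_step hi hj
  obtain ⟨l, hl, hl'⟩ := exists_step (a := -1) hj (by simpa using hi)
  have hkl : k ≠ l := by
    rintro rfl
    rw [hk] at hl
    exact absurd hl (by decide)
  have hsub : ∑ m ∈ {k, l}, (1 - ((f m : ℤ) : ℝ) * ((f (m + 1) : ℤ) : ℝ))
      ≤ ∑ m, (1 - ((f m : ℤ) : ℝ) * ((f (m + 1) : ℤ) : ℝ)) := by
    refine Finset.sum_le_sum_of_subset_of_nonneg (Finset.subset_univ _) fun m _ _ => ?_
    rcases Int.units_eq_one_or (f m) with h1 | h1 <;>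
      rcases Int.units_eq_one_or (f (m + 1)) with h2 | h2 <;> simp [h1, h2]
  rw [Finset.sum_pair hkl, hk, hk', hl, hl'] at hsub
  norm_num at hsub
  simpa using hsub

/-- The number of pluses. -/
def plusCount {L : ℕ} [NeZero L] (s : Config L) : ℕ := (Finset.univ.filter fun x => s x = 1).card

/-- The horizontal lines on which `s` is not constant. -/
def mixedRows {L : ℕ} [NeZero L] (s : Config L) : Finset (ZMod L) :=
  Finset.univ.filter fun y => ∃ i j, s (i, y) = 1 ∧ s (j, y) = -1

/-- The vertical lines on which `s` is not constant. -/
def mixedCols {L : ℕ} [NeZero L] (s : Config L) : Finset (ZMod L) :=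
  Finset.univ.filter fun x => ∃ i j, s (x, i) = 1 ∧ s (x, j) = -1

theorem sum_spin {L : ℕ} [NeZero L] (s : Config L) :
    ∑ x, spin s x = 2 * plusCount s - (L : ℝ) ^ 2 := by
  have : ∀ x, spin s x = 2 * (if s x = 1 then 1 else 0) - 1 := fun x => by
    rcases spin_cases s x with ⟨h1, h2⟩ | ⟨h1, h2⟩ <;> rw [h1, h2] <;> norm_num
  simp only [this, Finset.sum_sub_distrib, ← Finset.mul_sum, Finset.sum_boole, plusCount]
  simp [ZMod.card, sq]

theorem sum_spin_mul_S {L : ℕ} [NeZero L] (h2 : 2 < L) (s : Config L) :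
    ∑ x, spin s x * S s x = 2 * ∑ x, spin s x * spin s (x + (1, 0))
      + 2 * ∑ x, spin s x * spin s (x + (0, 1)) := by
  have shift : ∀ z : Site L, ∑ x, spin s x * spin s (x - z) = ∑ x, spin s x * spin s (x + z) := by
    intro z
    rw [← Equiv.sum_comp (Equiv.addRight z)]
    exact Finset.sum_congr rfl fun x _ => by simp [mul_comm]
  simp only [S_eq h2, mul_add, Finset.sum_add_distrib, shift]
  ring

theorem plusCount_allMinus {L : ℕ} [NeZero L] : plusCount (allMinus L) = 0 :=
  Finset.card_eq_zero.2 (Finset.filter_eq_empty_iff.2 fun _ _ => by unfold allMinus; decide)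

theorem ising_sub_allMinus {L : ℕ} [NeZero L] (h2 : 2 < L) (h : ℝ) (s : Config L) :
    ising h s - ising h (allMinus L) = ∑ x, (1 - spin s x * spin s (x + (1, 0)))
      + ∑ x, (1 - spin s x * spin s (x + (0, 1))) - 2 * h * plusCount s := by
  have hd : plusCount (allMinus L) = 0 := 
    Finset.card_eq_zero.2 (Finset.filter_eq_empty_iff.2 fun _ _ => by unfold allMinus; decide)
  unfold ising
  rw [sum_spin_mul_S h2, sum_spin_mul_S h2, sum_spin, sum_spin, plusCount_allMinus]
  simp only [Finset.sum_sub_distrib]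
  simp [spin, allMinus]
  ring

/-- The interface energy is summed line by line, and each nonconstant line contributes at least 4 by
`four_le_sum_cyclic`. -/
theorem ising_ge_mixed {L : ℕ} [NeZero L] (h2 : 2 < L) (h : ℝ) (s : Config L) :
    4 * ((mixedCols s).card + (mixedRows s).card : ℝ) - 2 * h * plusCount s
      ≤ ising h s - ising h (allMinus L) := by
  have nn : ∀ x y, 0 ≤ 1 - spin s x * spin s y := fun x y => by
    rcases spin_cases s x with ⟨-, a⟩ | ⟨-, a⟩ <;> rcases spin_cases s y with ⟨-, b⟩ | ⟨-, b⟩ <;>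
      rw [a, b] <;> norm_num
  have key : ∀ (T : Finset (ZMod L)) (g : ZMod L → ℝ), (∀ y, 0 ≤ g y) → (∀ y ∈ T, 4 ≤ g y) →
      4 * (T.card : ℝ) ≤ ∑ y, g y := by
    intro T g hg hT
    calc 4 * (T.card : ℝ) = ∑ y ∈ T, (4 : ℝ) := by simp [mul_comm]
      _ ≤ ∑ y ∈ T, g y := Finset.sum_le_sum hT
      _ ≤ _ := Finset.sum_le_sum_of_subset_of_nonneg (Finset.subset_univ _) fun y _ _ => hg y
  have hr : 4 * ((mixedRows s).card : ℝ) ≤ ∑ x, (1 - spin s x * spin s (x + (1, 0))) := by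
    rw [Fintype.sum_prod_type_right]
    refine key _ _ (fun y => Finset.sum_nonneg fun _ _ => nn _ _) fun y hy => ?_
    obtain ⟨i, j, hi, hj⟩ := (Finset.mem_filter.1 hy).2
    simpa [spin] using four_le_sum_cyclic (f := fun k => s (k, y)) hi hj
  have hc : 4 * ((mixedCols s).card : ℝ) ≤ ∑ x, (1 - spin s x * spin s (x + (0, 1))) := by
    rw [Fintype.sum_prod_type]
    refine key _ _ (fun y => Finset.sum_nonneg fun _ _ => nn _ _) fun y hy => ?_
    obtain ⟨i, j, hi, hj⟩ := (Finset.mem_filter.1 hy).2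
    simpa [spin] using four_le_sum_cyclic (f := fun k => s (y, k)) hi hj
  rw [ising_sub_allMinus h2]
  linarith

theorem plusCount_le_of_no_full_line {L : ℕ} [NeZero L] {s : Config L}
    (hr : ∀ y, ∃ i, s (i, y) = -1) (hc : ∀ x, ∃ j, s (x, j) = -1) :
    plusCount s ≤ (mixedCols s).card * (mixedRows s).card := by
  rw [← Finset.card_product]
  refine Finset.card_le_card fun x hx => ?_
  have hx' : s x = 1 := (Finset.mem_filter.1 hx).2
  obtain ⟨i, hi⟩ := hr x.2
  obtain ⟨j, hj⟩ := hc x.1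
  simp only [Finset.mem_product, mixedCols, mixedRows, Finset.mem_filter, Finset.mem_univ, true_and]
  exact ⟨⟨x.2, j, hx', hj⟩, ⟨x.1, i, hx', hi⟩⟩

theorem ne_one_iff {a : ℤˣ} : a ≠ 1 ↔ a = -1 := by
  rcases Int.units_eq_one_or a with rfl | rfl <;> decide

/-- With no full plus line, every plus lies on a mixed row and a mixed column. If there are full
plus lines in one direction only, they make all lines of the other direction mixed. With full plus
lines in both directions, the minuses obey the bound that the pluses obey in the first case. -/
theorem mixed_cases {L : ℕ} [NeZero L] (s : Config L) :
    plusCount s ≤ (mixedCols s).card * (mixedRows s).card ∨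
      L ≤ (mixedCols s).card + (mixedRows s).card ∨
      L * L ≤ plusCount s + (mixedCols s).card * (mixedRows s).card := by
  have full : ∀ T : Finset (ZMod L), (∀ y, y ∈ T) → L ≤ T.card := fun T hT => by
    rw [Finset.eq_univ_iff_forall.2 hT, Finset.card_univ, ZMod.card]
  by_cases hr : ∀ y, ∃ i, s (i, y) = -1 <;> by_cases hc : ∀ x, ∃ j, s (x, j) = -1
  · exact Or.inl (plusCount_le_of_no_full_line hr hc)
  · push Not at hc
    obtain ⟨x, hx⟩ := hc
    refine Or.inr (Or.inl ((full _ fun y => ?_).trans (Nat.le_add_left _ _)))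
    obtain ⟨i, hi⟩ := hr y
    simp only [mixedRows, Finset.mem_filter, Finset.mem_univ, true_and]
    exact ⟨x, i, by_contra fun hn => hx y (ne_one_iff.1 hn), hi⟩
  · push Not at hr
    obtain ⟨y, hy⟩ := hr
    refine Or.inr (Or.inl ((full _ fun x => ?_).trans (Nat.le_add_right _ _)))
    obtain ⟨j, hj⟩ := hc x
    simp only [mixedCols, Finset.mem_filter, Finset.mem_univ, true_and]
    exact ⟨y, j, by_contra fun hn => hy x (ne_one_iff.1 hn), hj⟩
  · push Not at hr hc
    obtain ⟨x, hx⟩ := hc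
    obtain ⟨y, hy⟩ := hr
    refine Or.inr (Or.inr ?_)
    have hcard : (Finset.univ.filter fun z : Site L => ¬ s z = 1).card
        ≤ (mixedCols s).card * (mixedRows s).card := by
      rw [← Finset.card_product]
      refine Finset.card_le_card fun z hz => ?_
      have hz' : s z = -1 := ne_one_iff.1 (Finset.mem_filter.1 hz).2
      simp only [Finset.mem_product, mixedCols, mixedRows, Finset.mem_filter, Finset.mem_univ,
        true_and]
      exact ⟨⟨y, z.2, by_contra fun hn => hy _ (ne_one_iff.1 hn), hz'⟩,
        ⟨x, z.1, by_contra fun hn => hx _ (ne_one_iff.1 hn), hz'⟩⟩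
    have := Finset.card_filter_add_card_filter_not (s := (Finset.univ : Finset (Site L)))
      (fun z => s z = 1)
    rw [Finset.card_univ, Fintype.card_prod, ZMod.card] at this
    unfold plusCount
    omega

/-! ### The critical length -/

theorem two_lt_mul_critLength {h : ℝ} (h_pos : 0 < h) : 2 < h * critLength h := by
  have := Nat.lt_floor_add_one (2 / h)
  rw [div_lt_iff₀ h_pos] at this
  simp only [critLength]
  push_cast
  linarith

theorem mul_critLength_sub_one_le {h : ℝ} (h_pos : 0 < h) : h * ((critLength h : ℝ) - 1) ≤ 2 := by
  have := Nat.floor_le (a := 2 / h) (by positivity)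
  rw [le_div_iff₀ h_pos] at this
  simp only [critLength]
  push_cast
  linarith

theorem three_le_critLength {h : ℝ} (h_pos : 0 < h) (h_lt : h < 1) : 3 ≤ critLength h := by
  have : 2 ≤ ⌊2 / h⌋₊ := Nat.le_floor (by rw [le_div_iff₀ h_pos]; push_cast; linarith)
  unfold critLength
  omega

/-- The number of pluses of a critical droplet. -/
def critCount (h : ℝ) : ℕ := critLength h * (critLength h - 1) + 1

theorem critCount_cast {h : ℝ} :
    (critCount h : ℝ) = (critLength h : ℝ) * ((critLength h : ℝ) - 1) + 1 := by
  have : 1 ≤ critLength h := Nat.le_add_left _ _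
  unfold critCount
  push_cast [Nat.cast_sub this]
  ring

theorem mixed_of_plusCount_le {L : ℕ} [NeZero L] {h : ℝ} (L_large : 2 * critLength h ≤ L)
    {s : Config L} (hs : plusCount s ≤ critCount h) :
    plusCount s ≤ (mixedCols s).card * (mixedRows s).card ∨
      2 * critLength h ≤ (mixedCols s).card + (mixedRows s).card := by
  rcases mixed_cases s with h1 | h1 | h1
  · exact Or.inl h1
  · exact Or.inr (L_large.trans h1)
  -- The pluses number at most a quarter of `L * L`, so the mixed rectangle, which holds all the
  -- minuses, is larger than the set of pluses.
  · left
    have hl : 1 ≤ critLength h := Nat.le_add_left _ _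
    unfold critCount at hs
    obtain ⟨m, hm⟩ := Nat.exists_eq_add_of_le hl
    rw [hm] at hs L_large
    have : (2 * (1 + m)) * (2 * (1 + m)) ≤ L * L := Nat.mul_le_mul L_large L_large
    have e : 1 + m - 1 = m := by omega
    rw [e] at hs
    nlinarith

/-- Integer form of the arithmetic–geometric mean inequality: `a + b ≤ 2l - 1` forces `a * b ≤ l *
(l - 1)`. -/
theorem le_add_of_lt_mul {l a b : ℕ} (hab : l * (l - 1) < a * b) : 2 * l ≤ a + b := by
  by_contra! hc
  rcases Nat.eq_zero_or_pos l with rfl | hl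
  · omega
  obtain ⟨m, rfl⟩ := Nat.exists_eq_add_of_le hl
  have e : 1 + m - 1 = m := by omega
  rw [e] at hab
  have h1 : a + b ≤ 2 * m + 1 := by omega
  rcases le_total a b with h2 | h2
  · have : a ≤ m := by omega
    obtain ⟨k, rfl⟩ := Nat.exists_eq_add_of_le this
    have : b ≤ a + k + 1 + k := by omega
    nlinarith
  · have : b ≤ m := by omega
    obtain ⟨k, rfl⟩ := Nat.exists_eq_add_of_le this
    have : a ≤ b + k + 1 + k := by omega
    nlinarith

theorem activationEnergy_eq (h : ℝ) :
    activationEnergy h = 8 * critLength h - 2 * h * critCount h := by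
  rw [critCount_cast]; unfold activationEnergy; ring

/-- A configuration with the critical number of pluses has at least the activation energy. -/
theorem activationEnergy_le {L : ℕ} [NeZero L] {h : ℝ} (h2 : 2 < L)
    (L_large : 2 * critLength h ≤ L) {s : Config L} (hs : plusCount s = critCount h) :
    ising h (allMinus L) + activationEnergy h ≤ ising h s := by
  have hm : 2 * critLength h ≤ (mixedCols s).card + (mixedRows s).card := by
    rcases mixed_of_plusCount_le L_large hs.le with h1 | h1
    · exact le_add_of_lt_mul (lt_of_lt_of_le (by rw [hs]; exact Nat.lt_succ_self _) h1)
    · exact h1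
  have := ising_ge_mixed h2 h s
  have hm' : (2 * critLength h : ℝ) ≤ (mixedCols s).card + (mixedRows s).card := by
    exact_mod_cast hm
  rw [activationEnergy_eq, ← hs]
  linarith

/-- Below the critical count, the gain `2hA` from the field on `A` pluses does not exceed the
interface cost `4(a + b)`. -/
theorem ising_allMinus_le {L : ℕ} [NeZero L] {h : ℝ} (h2 : 2 < L) (h_pos : 0 < h) (h_lt : h < 1)
    (L_large : 2 * critLength h ≤ L) {s : Config L} (hs : plusCount s < critCount h) :
    ising h (allMinus L) ≤ ising h s := by
  have := ising_ge_mixed h2 h s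
  have hA : (plusCount s : ℝ) ≤ (critLength h : ℝ) * ((critLength h : ℝ) - 1) := by
    have h1 : (plusCount s : ℝ) + 1 ≤ critCount h := by exact_mod_cast hs
    rw [critCount_cast] at h1
    linarith
  have h3 : (3 : ℝ) ≤ critLength h := by exact_mod_cast three_le_critLength h_pos h_lt
  have hl := mul_critLength_sub_one_le h_pos
  set l : ℝ := (critLength h : ℝ)
  set A : ℝ := (plusCount s : ℝ)
  have hA0 : 0 ≤ A := Nat.cast_nonneg _
  have hhA : h * A ≤ 2 * l := by nlinarith
  rcases mixed_of_plusCount_le L_large hs.le with h1 | h1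
  · have h1' : A ≤ (mixedCols s).card * (mixedRows s).card := by
      change (plusCount s : ℝ) ≤ _
      exact_mod_cast h1
    set a : ℝ := ((mixedCols s).card : ℝ)
    set b : ℝ := ((mixedRows s).card : ℝ)
    have ha : 0 ≤ a := Nat.cast_nonneg _
    have hb : 0 ≤ b := Nat.cast_nonneg _
    have hhl : h * l ≤ 3 := by nlinarith
    -- Here `h * l ≤ 3` gives `(h * A) ^ 2 ≤ 6 * A ≤ 6 * a * b`, well below `4 * (a + b) ^ 2`.
    have h4 : (h * A) ^ 2 ≤ (2 * (a + b)) ^ 2 := by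
      have h5 : h * (h * A) ≤ 6 := by nlinarith
      have h6 : (h * A) ^ 2 ≤ 6 * A := by nlinarith
      nlinarith [sq_nonneg (a - b)]
    have := abs_le_of_sq_le_sq' h4 (by positivity)
    linarith [this.2]
  · have hm' : (2 * l : ℝ) ≤ (mixedCols s).card + (mixedRows s).card := by
      change (2 * critLength h : ℝ) ≤ _
      exact_mod_cast h1
    linarith

/-! ### Crossing the critical number of pluses -/

theorem plusCount_update_le {L : ℕ} [NeZero L] (s : Config L) (x : Site L) (a : ℤˣ) :
    plusCount (Function.update s x a) ≤ plusCount s + 1 := by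
  refine (Finset.card_le_card (t := insert x (Finset.univ.filter fun y => s y = 1)) ?_).trans
    (Finset.card_insert_le _ _)
  intro y hy
  by_cases hyx : y = x
  · simp [hyx]
  · simpa [hyx] using hy

theorem le_plusCount_update {L : ℕ} [NeZero L] (s : Config L) (x : Site L) (a : ℤˣ) :
    plusCount s ≤ plusCount (Function.update s x a) + 1 := by
  simpa using plusCount_update_le (Function.update s x a) x (s x)

theorem eq_neg_of_ne {a b : ℤˣ} (hab : a ≠ b) : b = -a := by
  rcases Int.units_eq_one_or a with rfl | rfl <;> rcases Int.units_eq_one_or b with rfl | rfl <;>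
    simp_all

/-- Two configurations which differ on one sublattice only are joined by single flips that never
exceed the larger of the two energies. -/
theorem exists_plusCount_eq {L : ℕ} [NeZero L] (hL : Even L) (h2 : 2 < L) {h c : ℝ} {n : ℕ}
    {q : ZMod 2} (k : ℕ) : ∀ s t : Config L, (Finset.univ.filter fun x => s x ≠ t x).card ≤ k →
      (∀ x, s x ≠ t x → par x = q) → plusCount s < n → n ≤ plusCount t →
      ising h s < c → ising h t < c → ∃ r : Config L, plusCount r = n ∧ ising h r < c := by
  induction k with
  | zero =>
    intro s t hk _ hs ht _ _
    have : s = t := by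
      funext x
      by_contra hx
      have : x ∈ Finset.univ.filter fun x => s x ≠ t x := by simpa using hx
      rw [Finset.card_eq_zero.1 (Nat.le_zero.1 hk)] at this
      simp at this
    subst this
    omega
  | succ k ih =>
    intro s t hk hq hs ht hsc htc
    obtain ⟨x, hx⟩ : ∃ x, s x ≠ t x := by
      by_contra! hc
      rw [funext hc] at hs
      omega
    have hxm : x ∈ Finset.univ.filter fun y => s y ≠ t y := by simpa using hx
    have hcard : ((Finset.univ.filter fun y => s y ≠ t y).erase x).card ≤ k := by
      rw [Finset.card_erase_of_mem hxm]; omega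
    have hS : S s x = S t x := S_congr hL h2 fun y hy => by
      by_contra hc
      exact hy (by rw [hq y hc, hq x hx])
    have htx : t x = -s x := eq_neg_of_ne hx
    have hsx : s x = -t x := by rw [htx, neg_neg]
    have f1 := ising_flip hL h2 h s x
    have f2 := ising_flip hL h2 h t x
    have hspin : spin t x = -spin s x := by simp [spin, htx]
    rw [← htx] at f1
    rw [← hsx, ← hS, hspin] at f2
    -- Since `s` and `t` feel the same field at `x`, moving `s` towards `t` there and moving `t`
    -- towards `s` change the energy by opposite amounts, so one of the moves does not raise it. It
    -- shifts the plus count by at most one, so it either keeps `n` bracketed or meets it.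
    rcases le_total (spin s x * (S s x + h)) 0 with hle | hle
    · have hs' : ising h (Function.update s x (t x)) < c := by linarith
      by_cases hn : plusCount (Function.update s x (t x)) < n
      · refine ih _ t ((Finset.card_le_card fun y hy => ?_).trans hcard) (fun y hy => ?_) hn ht hs' htc
        · by_cases hyx : y = x
          · subst hyx; simp at hy
          · simpa [hyx] using hy
        · by_cases hyx : y = x
          · subst hyx; exact hq y hx
          · exact hq y (by simpa [hyx] using hy)
      · have := plusCount_update_le s x (t x)
        exact ⟨_, by omega, hs'⟩
    · have ht' : ising h (Function.update t x (s x)) < c := by linarith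
      by_cases hn : n ≤ plusCount (Function.update t x (s x))
      · refine ih s _ ((Finset.card_le_card fun y hy => ?_).trans hcard) (fun y hy => ?_) hs hn hsc ht'
        · by_cases hyx : y = x
          · subst hyx; simp at hy
          · simpa [hyx] using hy
        · by_cases hyx : y = x
          · subst hyx; exact hq y hx
          · exact hq y (by simpa [hyx] using hy)
      · have := le_plusCount_update t x (s x)
        exact ⟨t, by omega, htc⟩

/-- Two completions of the same half, both below the barrier, lie on the same side of the critical
count: otherwise the flips between them would hit that count below its least energy. -/
theorem plusCount_mix_lt {L : ℕ} [NeZero L] (hL : Even L) (h2 : 2 < L) {h : ℝ}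
    (L_large : 2 * critLength h ≤ L) {p : ZMod 2} {σ η ξ : Config L}
    (hs : plusCount (mix p σ η) < critCount h)
    (hη : ising h (mix p σ η) < ising h (allMinus L) + activationEnergy h)
    (hξ : ising h (mix p σ ξ) < ising h (allMinus L) + activationEnergy h) :
    plusCount (mix p σ ξ) < critCount h := by
  by_contra! hc
  obtain ⟨r, hr, hr'⟩ := exists_plusCount_eq hL h2 (q := p + 1) _ (mix p σ η) (mix p σ ξ) le_rfl
    (fun x hx => zmod_two_ne.1 fun hp => hx (by simp [mix, hp])) hs hc hη hξ
  exact (activationEnergy_le h2 L_large hr).not_gt hr'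

/-- The half of `σ` of parity `p`, relaxed on the other sublattice, has fewer pluses than a
critical droplet. -/
def Subcritical {L : ℕ} [NeZero L] (h : ℝ) (p : ZMod 2) (σ : Config L) : Prop :=
  plusCount (mix p σ (follow h σ)) < critCount h

/-- The configuration `mix p σ η` completes both the half of `σ` of parity `p` and the half of `η`
of parity `p + 1`; subcriticality passes through it from one relaxed half to the next. -/
theorem Subcritical.step {L : ℕ} [NeZero L] (hL : Even L) (h2 : 2 < L) {h : ℝ}
    (L_large : 2 * critLength h ≤ L) {p : ZMod 2} {σ η : Config L} (hs : Subcritical h p σ)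
    (hη : ising h (mix p σ η) < ising h (allMinus L) + activationEnergy h) :
    Subcritical h (p + 1) η := by
  have h1 := plusCount_mix_lt hL h2 L_large hs ((halfEnergy_le hL h2 h p σ η).trans_lt hη) hη
  rw [← mix_comm] at h1 hη
  exact plusCount_mix_lt hL h2 L_large h1 hη ((halfEnergy_le hL h2 h (p + 1) η σ).trans_lt hη)

theorem Subcritical.le_halfEnergy {L : ℕ} [NeZero L] {h : ℝ} (h2 : 2 < L) (h_pos : 0 < h)
    (h_lt : h < 1) (L_large : 2 * critLength h ≤ L) {p : ZMod 2} {σ : Config L}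
    (hs : Subcritical h p σ) : ising h (allMinus L) ≤ halfEnergy h p σ :=
  ising_allMinus_le h2 h_pos h_lt L_large hs

/-! ### Halves that are constant -/

theorem halfEnergy_of_plus {L : ℕ} [NeZero L] (hL : Even L) (h2 : 2 < L) {h : ℝ} (h_pos : 0 < h)
    {p : ZMod 2} {σ : Config L} (hσ : ∀ x, par x = p → σ x = 1) :
    halfEnergy h p σ = ising h (allPlus L) := by
  refine le_antisymm ?_ (ising_allPlus_le_ising h_pos _)
  have e : mix p σ (allPlus L) = allPlus L := by
    funext x
    unfold mix
    split_ifs with hx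
    · exact hσ x hx
    · rfl
  simpa [e] using halfEnergy_le hL h2 h p σ (allPlus L)

theorem mix_follow_of_minus {L : ℕ} [NeZero L] (hL : Even L) (h2 : 2 < L) {h : ℝ} (h_lt : h < 1)
    {p : ZMod 2} {σ : Config L} (hσ : ∀ x, par x = p → σ x = -1) :
    mix p σ (follow h σ) = allMinus L := by
  funext x
  unfold mix
  split_ifs with hx
  · exact hσ x hx
  · have : S σ x = S (allMinus L) x := S_congr hL h2 fun y hy => by
      rw [hσ y, allMinus]
      rw [zmod_two_ne.1 hx] at hy
      exact zmod_two_ne_add_one.1 hy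
    have h4 : S (allMinus L) x = -4 := by
      rw [S_eq h2]; simp [spin, allMinus]; norm_num
    rw [follow, this, h4, if_neg (by linarith), allMinus]

theorem halfEnergy_of_minus {L : ℕ} [NeZero L] (hL : Even L) (h2 : 2 < L) {h : ℝ} (h_lt : h < 1)
    {p : ZMod 2} {σ : Config L} (hσ : ∀ x, par x = p → σ x = -1) :
    halfEnergy h p σ = ising h (allMinus L) := by
  rw [halfEnergy, mix_follow_of_minus hL h2 h_lt hσ]

theorem energy_allMinus {L : ℕ} [NeZero L] (hL : Even L) (h2 : 2 < L) {h : ℝ} (h_lt : h < 1) :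
    energy h (allMinus L) = ising h (allMinus L) + ising h (allMinus L) := by
  have hm : ∀ p : ZMod 2, halfEnergy h p (allMinus L) = ising h (allMinus L) := fun p =>
    halfEnergy_of_minus hL h2 h_lt fun _ _ => rfl
  rw [energy_eq hL h2 h 0, hm, hm]

theorem subcritical_of_minus {L : ℕ} [NeZero L] (hL : Even L) (h2 : 2 < L) {h : ℝ} (h_lt : h < 1)
    {p : ZMod 2} {σ : Config L} (hσ : ∀ x, par x = p → σ x = -1) : Subcritical h p σ := by
  rw [Subcritical, mix_follow_of_minus hL h2 h_lt hσ, plusCount_allMinus]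
  exact Nat.succ_pos _

/-! ### Lower bounds on the stability level -/

theorem le_height_of_invariant {L : ℕ} [NeZero L] {h c : ℝ} {I : Config L → Prop}
    (hI : ∀ σ η, I σ → commHeight h σ η < c → I η) (n : ℕ) (ω : Fin (n + 1) → Config L)
    (h0 : I (ω 0)) (hn : ¬ I (ω (Fin.last n))) : c ≤ height h n ω := by
  by_contra! hlt
  cases n with
  | zero => exact hn h0
  | succ n =>
    have hstep : ∀ i : Fin (n + 1), commHeight h (ω i.castSucc) (ω i.succ) < c := fun i =>
      (Finset.sup'_lt_iff ⟨i, Finset.mem_univ i⟩).1 hlt i (Finset.mem_univ i)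
    have hall : ∀ i : Fin (n + 2), I (ω i) := fun i => by
      induction i using Fin.induction with
      | zero => exact h0
      | succ i ih => exact hI _ _ ih (hstep i)
    exact hn (hall _)

/-- A path to lower energy has to leave `I`, and every step out of `I` has height at least `energy h
σ + g`. -/
theorem le_stabilityLevel_of_invariant {L : ℕ} [NeZero L] {h g : ℝ} {I : Config L → Prop}
    {σ : Config L} (hI : ∀ ξ η, I ξ → commHeight h ξ η < energy h σ + g → I η) (hσ : I σ)
    (hlow : ∀ η, I η → energy h σ ≤ energy h η) : (g : EReal) ≤ stabilityLevel h σ := by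
  unfold stabilityLevel
  refine EReal.le_sub_iff_add_le (by simp) (by simp) |>.2 ?_
  unfold minimaxSet minimax
  refine le_iInf₂ fun η hη => le_iInf fun n => le_iInf fun ω => le_iInf fun h0 => le_iInf fun hn => ?_
  rw [← EReal.coe_add, EReal.coe_le_coe_iff, add_comm]
  refine le_height_of_invariant hI n ω (h0 ▸ hσ) fun hc => ?_
  rw [hn] at hc
  exact (hlow η hc).not_gt hη

theorem le_stabilityLevel_allMinus {L : ℕ} [NeZero L] (hL : Even L) (h2 : 2 < L) {h : ℝ}
    (h_pos : 0 < h) (h_lt : h < 1) (L_large : 2 * critLength h ≤ L) :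
    (activationEnergy h : EReal) ≤ stabilityLevel h (allMinus L) := by
  have hE := energy_allMinus hL h2 h_lt
  refine le_stabilityLevel_of_invariant (I := fun σ => ∀ p, Subcritical h p σ) ?_
    (fun p => subcritical_of_minus hL h2 h_lt fun _ _ => rfl) ?_
  · intro σ η hσ hlt p
    have hp : p = (p + 1) + 1 := by revert p; decide
    rw [hp]
    refine (hσ (p + 1)).step hL h2 L_large ?_
    rw [commHeight_eq hL h2 h (p + 1), hE] at hlt
    -- The other trajectory stays at or above the energy of all minus, so a total below the
    -- threshold leaves this one less than the activation energy.
    have := ((hσ (p + 1 + 1)).le_halfEnergy h2 h_pos h_lt L_large).trans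
      (halfEnergy_le hL h2 h (p + 1 + 1) σ η)
    linarith
  · intro η hη
    rw [energy_eq hL h2 h 0 η, hE]
    exact add_le_add ((hη _).le_halfEnergy h2 h_pos h_lt L_large)
      ((hη _).le_halfEnergy h2 h_pos h_lt L_large)

/-- The plus half already has the least possible energy, so it cannot help pay for the barrier. The
trapped trajectory changes sublattice at each step, hence the existential over `q` in the invariant.
-/
theorem le_stabilityLevel_of_half_minus {L : ℕ} [NeZero L] (hL : Even L) (h2 : 2 < L) {h : ℝ}
    (h_pos : 0 < h) (h_lt : h < 1) (L_large : 2 * critLength h ≤ L) {p : ZMod 2} {σ : Config L}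
    (hm : ∀ x, par x = p → σ x = -1) (hp : ∀ x, par x = p + 1 → σ x = 1) :
    (activationEnergy h : EReal) ≤ stabilityLevel h σ := by
  have hE : energy h σ = ising h (allMinus L) + ising h (allPlus L) := by
    rw [energy_eq hL h2 h p, halfEnergy_of_minus hL h2 h_lt hm, halfEnergy_of_plus hL h2 h_pos hp]
  refine le_stabilityLevel_of_invariant (I := fun σ => ∃ q, Subcritical h q σ) ?_
    ⟨p, subcritical_of_minus hL h2 h_lt hm⟩ ?_
  · rintro ξ η ⟨q, hq⟩ hlt
    refine ⟨q + 1, hq.step hL h2 L_large ?_⟩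
    rw [commHeight_eq hL h2 h q, hE] at hlt
    have := ising_allPlus_le_ising h_pos (mix (q + 1) ξ η)
    linarith
  · rintro η ⟨q, hq⟩
    rw [energy_eq hL h2 h q η, hE]
    exact add_le_add (hq.le_halfEnergy h2 h_pos h_lt L_large) (ising_allPlus_le_ising h_pos _)

/-! ### Growing a droplet along the pairing function -/

/-- Half the perimeter of the set of the first `j` pairs of natural numbers in the order of
`Nat.pair`. -/
def halfPerimeter (j : ℕ) : ℕ :=
  ((Finset.range j).filter fun i => (Nat.unpair i).1 = 0).card
    + ((Finset.range j).filter fun i => (Nat.unpair i).2 = 0).card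

theorem halfPerimeter_succ (j : ℕ) : halfPerimeter (j + 1) = halfPerimeter j
    + ((if (Nat.unpair j).1 = 0 then 1 else 0) + (if (Nat.unpair j).2 = 0 then 1 else 0)) := by
  unfold halfPerimeter
  rw [Finset.range_add_one, Finset.filter_insert, Finset.filter_insert]
  split_ifs <;> simp <;> ring

/-- `Nat.pair 0 b = b * b`, so indices with vanishing first coordinate are squares. Similarly
`Nat.pair a 0 = a * a + a` in the companion lemma. -/
theorem card_unpair_fst_le {j l : ℕ} (hj : j ≤ l * l) :
    ((Finset.range j).filter fun i => (Nat.unpair i).1 = 0).card ≤ l := by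
  refine (Finset.card_le_card (t := (Finset.range l).image fun b => b * b) fun i hi => ?_).trans
    (Finset.card_image_le.trans (Finset.card_range l).le)
  obtain ⟨h1, h2⟩ := Finset.mem_filter.1 hi
  have hp : i = (Nat.unpair i).2 * (Nat.unpair i).2 := by
    conv_lhs => rw [← Nat.pair_unpair i, h2, Nat.pair]
    split_ifs with hc
    · ring
    · have : (Nat.unpair i).2 = 0 := by omega
      simp [this]
  rw [Finset.mem_image]
  refine ⟨_, Finset.mem_range.2 ?_, hp.symm⟩
  have := Finset.mem_range.1 h1
  by_contra! hc
  have := Nat.mul_le_mul hc hc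
  omega

theorem card_unpair_snd_le {j l : ℕ} (hj : j ≤ l * l + l) :
    ((Finset.range j).filter fun i => (Nat.unpair i).2 = 0).card ≤ l := by
  refine (Finset.card_le_card (t := (Finset.range l).image fun b => b * b + b) fun i hi => ?_).trans
    (Finset.card_image_le.trans (Finset.card_range l).le)
  obtain ⟨h1, h2⟩ := Finset.mem_filter.1 hi
  have hp : i = (Nat.unpair i).1 * (Nat.unpair i).1 + (Nat.unpair i).1 := by
    conv_lhs => rw [← Nat.pair_unpair i, h2, Nat.pair]
    simp
  rw [Finset.mem_image]
  refine ⟨_, Finset.mem_range.2 ?_, hp.symm⟩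
  have := Finset.mem_range.1 h1
  by_contra! hc
  have := Nat.mul_le_mul hc hc
  omega

theorem halfPerimeter_le_of_le_sq {j l : ℕ} (hj : j ≤ l * l) : halfPerimeter j ≤ 2 * l := by
  have h1 := card_unpair_fst_le hj
  have h2 := card_unpair_snd_le (hj.trans (Nat.le_add_right _ l))
  unfold halfPerimeter
  omega

theorem halfPerimeter_le_of_le_mul {j l : ℕ} (hj : j ≤ l * l + l) :
    halfPerimeter j ≤ 2 * l + 1 := by
  have h1 := card_unpair_fst_le (j := j) (l := l + 1) (by nlinarith)
  have h2 := card_unpair_snd_le hj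
  unfold halfPerimeter
  omega

/-- The sets of the first `k` pairs are optimal among the subsets of rectangles. -/
theorem halfPerimeter_le_add {k a b : ℕ} (hk : k ≤ a * b) : halfPerimeter k ≤ a + b := by
  rcases Nat.even_or_odd' (a + b) with ⟨l, hl | hl⟩
  · rw [hl]
    refine halfPerimeter_le_of_le_sq (hk.trans ?_)
    have : ((a : ℤ) + b) = 2 * l := by exact_mod_cast hl
    zify
    nlinarith [sq_nonneg ((a : ℤ) - b)]
  · rw [hl]
    refine halfPerimeter_le_of_le_mul (hk.trans ?_)
    by_contra! hc
    have h3 : (l + 1) * (l + 1 - 1) < a * b := by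
      rw [Nat.add_sub_cancel]; nlinarith
    have := le_add_of_lt_mul h3
    omega

/-- The energy, relative to all minuses, of the droplet made of the first `j` pairs. -/
def dropletEnergy (h : ℝ) (j : ℕ) : ℝ := 4 * halfPerimeter j - 2 * h * j

theorem dropletEnergy_one (h : ℝ) : dropletEnergy h 1 = 8 - 2 * h := by
  have : halfPerimeter 1 = 2 := by rw [halfPerimeter_succ]; simp [halfPerimeter]
  rw [dropletEnergy, this]; norm_num

/-- The concave quadratic on the left has its integer maximum at `critLength h`: the difference
factors, and both factors change sign there because `h * (critLength h - 1) ≤ 2 < h * critLength h`.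
-/
theorem activationEnergy_ge {h : ℝ} (h_pos : 0 < h) {l : ℕ} :
    8 * (l : ℝ) - 2 * h * (l * (l - 1) + 1) ≤ activationEnergy h := by
  have h1 := two_lt_mul_critLength h_pos
  have h2 := mul_critLength_sub_one_le h_pos
  rw [activationEnergy_eq, critCount_cast]
  have hfac : 8 * (critLength h : ℝ) - 2 * h * (critLength h * ((critLength h : ℝ) - 1) + 1)
      - (8 * (l : ℝ) - 2 * h * (l * (l - 1) + 1))
      = ((critLength h : ℝ) - l) * (8 - 2 * h * ((critLength h : ℝ) + l - 1)) := by ring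
  have : 0 ≤ ((critLength h : ℝ) - l) * (8 - 2 * h * ((critLength h : ℝ) + l - 1)) := by
    rcases lt_trichotomy l (critLength h) with hl | hl | hl
    · have hl' : (l : ℝ) + 1 ≤ critLength h := by exact_mod_cast hl
      exact mul_nonneg (by linarith) (by nlinarith)
    · simp [hl]
    · have hl' : (critLength h : ℝ) + 1 ≤ l := by exact_mod_cast hl
      exact mul_nonneg_of_nonpos_of_nonpos (by linarith) (by nlinarith)
  linarith

theorem activationEnergy_pos {h : ℝ} (h_pos : 0 < h) (h_lt : h < 1) : 0 < activationEnergy h := by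
  have := activationEnergy_ge h_pos (l := 1)
  norm_num at this
  linarith

theorem dropletEnergy_le {h : ℝ} (h_pos : 0 < h) (h_lt : h < 1) (j : ℕ) :
    dropletEnergy h j ≤ activationEnergy h := by
  rcases Nat.eq_zero_or_pos j with rfl | hj
  · simpa [dropletEnergy, halfPerimeter] using (activationEnergy_pos h_pos h_lt).le
  obtain ⟨k, rfl⟩ := Nat.exists_eq_add_of_le' hj
  -- The first plus past an `l × l` square is bounded by the mean of `g1` and `g2`, and the first
  -- past an `l × (l + 1)` rectangle by `g2`; further pluses on the same side only lower the energy.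
  set l := Nat.sqrt k
  have h1 : l * l ≤ k := Nat.sqrt_le k
  have h2 : k < (l + 1) * (l + 1) := Nat.lt_succ_sqrt k
  unfold dropletEnergy
  have g1 := activationEnergy_ge h_pos (l := l)
  have g2 := activationEnergy_ge h_pos (l := l + 1)
  have h1' : (l : ℝ) * l ≤ k := by exact_mod_cast h1
  push_cast at g2 ⊢
  by_cases hc : k + 1 ≤ l * l + l
  · have hq : (halfPerimeter (k + 1) : ℝ) ≤ 2 * l + 1 := by
      exact_mod_cast halfPerimeter_le_of_le_mul hc
    have : 2 * h * (l * l) ≤ 2 * h * k := by gcongr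
    linarith
  · have hq : (halfPerimeter (k + 1) : ℝ) ≤ 2 * (l + 1) := by
      exact_mod_cast halfPerimeter_le_of_le_sq (j := k + 1) (l := l + 1) (by omega)
    have h3 : (l : ℝ) * l + l ≤ k := by
      have : l * l + l ≤ k := by omega
      exact_mod_cast this
    have : 2 * h * (l * l + l) ≤ 2 * h * k := by gcongr
    linarith

theorem dropletEnergy_sq_neg {h : ℝ} (h_pos : 0 < h) (h_lt : h < 1) :
    dropletEnergy h ((2 * critLength h) * (2 * critLength h)) < 0 := by
  have hq : (halfPerimeter ((2 * critLength h) * (2 * critLength h)) : ℝ)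
      ≤ 2 * (2 * critLength h) := by exact_mod_cast halfPerimeter_le_of_le_sq le_rfl
  have h1 := two_lt_mul_critLength h_pos
  have h3 : (3 : ℝ) ≤ critLength h := by exact_mod_cast three_le_critLength h_pos h_lt
  unfold dropletEnergy
  push_cast
  nlinarith

/-- The side `2 * critLength h - 1` is at most `L - 1`, so this droplet leaves a free line in each
direction, as `dropletEnergy_le_ising` requires. -/
theorem dropletEnergy_sq_lt {h : ℝ} (h_pos : 0 < h) (h_lt : h < 1) :
    dropletEnergy h ((2 * critLength h - 1) * (2 * critLength h - 1)) < 8 - 2 * h := by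
  have hq : (halfPerimeter ((2 * critLength h - 1) * (2 * critLength h - 1)) : ℝ)
      ≤ 2 * (2 * critLength h - 1 : ℕ) := by exact_mod_cast halfPerimeter_le_of_le_sq le_rfl
  have h1 := two_lt_mul_critLength h_pos
  have h3' := three_le_critLength h_pos h_lt
  have h3 : (3 : ℝ) ≤ critLength h := by exact_mod_cast h3'
  have hc : ((2 * critLength h - 1 : ℕ) : ℝ) = 2 * critLength h - 1 := by
    push_cast [Nat.cast_sub (show 1 ≤ 2 * critLength h by omega)]; ring
  unfold dropletEnergy
  rw [Nat.cast_mul]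
  rw [hc] at hq ⊢
  nlinarith

/-- The `i`-th site of the growing droplet, with given corner and directions. -/
def dropletSite {L : ℕ} (x₀ e e' : Site L) (i : ℕ) : Site L :=
  x₀ + (Nat.unpair i).1 • e + (Nat.unpair i).2 • e'

/-- The droplet consisting of the first `j` sites. -/
def droplet {L : ℕ} (x₀ e e' : Site L) (j : ℕ) : Config L := open Classical in
  fun x => if ∃ i < j, dropletSite x₀ e e' i = x then 1 else -1

/-- The two coordinate directions, in either order. -/
def IsFrame {L : ℕ} (e e' : Site L) : Prop :=
  (e = (1, 0) ∧ e' = (0, 1)) ∨ (e = (0, 1) ∧ e' = (1, 0))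

theorem unpair_lt {i l : ℕ} (hi : i < l * l) : (Nat.unpair i).1 < l ∧ (Nat.unpair i).2 < l := by
  have h1 := Nat.max_sq_add_min_le_pair (Nat.unpair i).1 (Nat.unpair i).2
  rw [Nat.pair_unpair] at h1
  have : max (Nat.unpair i).1 (Nat.unpair i).2 < l := by
    by_contra! hc
    have := Nat.mul_le_mul hc hc
    rw [pow_two] at h1
    linarith [Nat.zero_le (min (Nat.unpair i).1 (Nat.unpair i).2)]
  exact max_lt_iff.1 this

theorem natCast_inj_of_lt {L a b : ℕ} (ha : a < L) (hb : b < L) (hab : (a : ZMod L) = b) :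
    a = b := by
  rw [ZMod.natCast_eq_natCast_iff', Nat.mod_eq_of_lt ha, Nat.mod_eq_of_lt hb] at hab
  exact hab

theorem dropletSite_injOn {L : ℕ} {x₀ e e' : Site L} (he : IsFrame e e') {i j : ℕ}
    (hi : i < L * L) (hj : j < L * L) (hij : dropletSite x₀ e e' i = dropletSite x₀ e e' j) :
    i = j := by
  obtain ⟨i1, i2⟩ := unpair_lt hi
  obtain ⟨j1, j2⟩ := unpair_lt hj
  have : (Nat.unpair i).1 = (Nat.unpair j).1 ∧ (Nat.unpair i).2 = (Nat.unpair j).2 := by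
    unfold dropletSite at hij
    rcases he with ⟨rfl, rfl⟩ | ⟨rfl, rfl⟩ <;> simp [Prod.ext_iff, add_assoc] at hij
    · exact ⟨natCast_inj_of_lt i1 j1 hij.1, natCast_inj_of_lt i2 j2 hij.2⟩
    · exact ⟨natCast_inj_of_lt i1 j1 hij.2, natCast_inj_of_lt i2 j2 hij.1⟩
  rw [← Nat.pair_unpair i, ← Nat.pair_unpair j, this.1, this.2]

theorem droplet_zero {L : ℕ} (x₀ e e' : Site L) : droplet x₀ e e' 0 = allMinus L := by
  funext x; simp [droplet, allMinus]

theorem droplet_apply_of_lt {L : ℕ} {x₀ e e' : Site L} {i j : ℕ} (hij : i < j) :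
    droplet x₀ e e' j (dropletSite x₀ e e' i) = 1 := if_pos ⟨i, hij, rfl⟩

theorem droplet_apply_self {L : ℕ} {x₀ e e' : Site L} (he : IsFrame e e') {j : ℕ}
    (hj : j < L * L) : droplet x₀ e e' j (dropletSite x₀ e e' j) = -1 :=
  if_neg fun ⟨_, hi, hij⟩ => hi.ne (dropletSite_injOn he (hi.trans hj) hj hij)

theorem droplet_succ_of_ne {L : ℕ} {x₀ e e' : Site L} {j : ℕ} {x : Site L}
    (hx : x ≠ dropletSite x₀ e e' j) : droplet x₀ e e' (j + 1) x = droplet x₀ e e' j x := by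
  unfold droplet
  congr 1
  rw [eq_iff_iff]
  constructor
  · rintro ⟨i, hi, rfl⟩
    rcases Nat.lt_succ_iff_lt_or_eq.1 hi with h1 | rfl
    · exact ⟨i, h1, rfl⟩
    · exact absurd rfl hx
  · rintro ⟨i, hi, rfl⟩
    exact ⟨i, hi.trans (Nat.lt_succ_self j), rfl⟩

theorem droplet_succ {L : ℕ} {x₀ e e' : Site L} (he : IsFrame e e') {j : ℕ} (hj : j < L * L) :
    droplet x₀ e e' (j + 1) = Function.update (droplet x₀ e e' j) (dropletSite x₀ e e' j)
      (-droplet x₀ e e' j (dropletSite x₀ e e' j)) := by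
  funext x
  by_cases hx : x = dropletSite x₀ e e' j
  · subst hx
    rw [Function.update_self, droplet_apply_self he hj, neg_neg,
      droplet_apply_of_lt (Nat.lt_succ_self j)]
  · rw [Function.update_of_ne hx, droplet_succ_of_ne hx]

theorem droplet_prev_fst {L : ℕ} {x₀ e e' : Site L} {j : ℕ} (hj : (Nat.unpair j).1 ≠ 0) :
    droplet x₀ e e' j (dropletSite x₀ e e' j - e) = 1 := by
  obtain ⟨a, ha⟩ := Nat.exists_eq_succ_of_ne_zero hj
  have hlt : Nat.pair a (Nat.unpair j).2 < j := by
    conv_rhs => rw [← Nat.pair_unpair j, ha]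
    exact Nat.pair_lt_pair_left _ (Nat.lt_succ_self a)
  rw [← droplet_apply_of_lt (x₀ := x₀) (e := e) (e' := e') hlt]
  congr 1
  simp only [dropletSite, Nat.unpair_pair, ha, Nat.succ_eq_add_one, add_smul, one_smul]
  abel

theorem droplet_prev_snd {L : ℕ} {x₀ e e' : Site L} {j : ℕ} (hj : (Nat.unpair j).2 ≠ 0) :
    droplet x₀ e e' j (dropletSite x₀ e e' j - e') = 1 := by
  obtain ⟨a, ha⟩ := Nat.exists_eq_succ_of_ne_zero hj
  have hlt : Nat.pair (Nat.unpair j).1 a < j := by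
    conv_rhs => rw [← Nat.pair_unpair j, ha]
    exact Nat.pair_lt_pair_right _ (Nat.lt_succ_self a)
  rw [← droplet_apply_of_lt (x₀ := x₀) (e := e) (e' := e') hlt]
  congr 1
  simp only [dropletSite, Nat.unpair_pair, ha, Nat.succ_eq_add_one, add_smul, one_smul]
  abel

/-- A new site has its predecessors in both directions already plus, except along the axes counted
by `halfPerimeter`. The forward neighbours are only bounded below by `-1`, so the estimate survives
wrapping around the torus. -/
theorem ising_droplet_le {L : ℕ} [NeZero L] (hL : Even L) (h2 : 2 < L) {h : ℝ} {x₀ e e' : Site L}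
    (he : IsFrame e e') {j : ℕ} (hj : j ≤ L * L) :
    ising h (droplet x₀ e e' j) ≤ ising h (allMinus L) + dropletEnergy h j := by
  induction j with
  | zero => simp [droplet_zero, dropletEnergy, halfPerimeter]
  | succ j ih =>
    have ih := ih (by omega)
    rw [droplet_succ he (by omega), ising_flip hL h2]
    set s := droplet x₀ e e' j with hs
    set x := dropletSite x₀ e e' j with hx
    have hsx : spin s x = -1 := by simp [spin, hs, hx, droplet_apply_self he (show j < L * L by omega)]
    have hS : S s x = spin s (x + e) + spin s (x - e) + spin s (x + e') + spin s (x - e') := by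
      rw [S_eq h2]
      rcases he with ⟨rfl, rfl⟩ | ⟨rfl, rfl⟩ <;> ring
    have b1 := neg_one_le_spin s (x + e)
    have b2 := neg_one_le_spin s (x + e')
    have b3 : 1 - 2 * (if (Nat.unpair j).1 = 0 then 1 else 0) ≤ spin s (x - e) := by
      split_ifs with hc
      · linarith [neg_one_le_spin s (x - e)]
      · simp [spin, hs, hx, droplet_prev_fst hc]
    have b4 : 1 - 2 * (if (Nat.unpair j).2 = 0 then 1 else 0) ≤ spin s (x - e') := by
      split_ifs with hc
      · linarith [neg_one_le_spin s (x - e')]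
      · simp [spin, hs, hx, droplet_prev_snd hc]
    unfold dropletEnergy at ih ⊢
    rw [halfPerimeter_succ]
    push_cast
    rw [hsx]
    linarith

/-! ### Chains of single flips out of a configuration -/

theorem exists_frame {L : ℕ} [NeZero L] {s : Config L} {a b : Site L} (ha : s a = 1)
    (hb : s b = -1) : ∃ x₀ e e' : Site L, IsFrame e e' ∧ s x₀ = 1 ∧ s (x₀ + e') = -1 := by
  by_cases hr : ∃ i, s (i, a.2) = -1
  · obtain ⟨i, hi⟩ := hr
    obtain ⟨k, hk, hk'⟩ := exists_step (f := fun k => s (k, a.2)) (i := a.1) (j := i) ha hi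
    exact ⟨(k, a.2), (0, 1), (1, 0), Or.inr ⟨rfl, rfl⟩, hk, by simpa using hk'⟩
  · push Not at hr
    have h1 : s (b.1, a.2) = 1 := by_contra fun hn => hr b.1 (ne_one_iff.1 hn)
    obtain ⟨k, hk, hk'⟩ := exists_step (f := fun k => s (b.1, k)) (i := a.2) (j := b.2) h1 hb
    exact ⟨(b.1, k), (1, 0), (0, 1), Or.inl ⟨rfl, rfl⟩, hk, by simpa using hk'⟩

theorem dropletSite_zero {L : ℕ} (x₀ e e' : Site L) : dropletSite x₀ e e' 0 = x₀ := by
  simp [dropletSite]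

theorem dropletSite_one {L : ℕ} (x₀ e e' : Site L) : dropletSite x₀ e e' 1 = x₀ + e' := by
  have : Nat.unpair 1 = (0, 1) := by
    have h1 : Nat.pair 0 1 = 1 := by simp [Nat.pair]
    conv_lhs => rw [← h1, Nat.unpair_pair]
  simp [dropletSite, this]

theorem dropletSite_coord {L : ℕ} {x₀ e e' : Site L} (he : IsFrame e e') {i l : ℕ}
    (hi : i < l * l) : ∃ a b : ℕ, a < l ∧ b < l ∧
      dropletSite x₀ e e' i = (x₀.1 + a, x₀.2 + b) := by
  obtain ⟨h1, h2⟩ := unpair_lt hi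
  rcases he with ⟨rfl, rfl⟩ | ⟨rfl, rfl⟩
  · exact ⟨_, _, h1, h2, by ext <;> simp [dropletSite]⟩
  · exact ⟨_, _, h2, h1, by ext <;> simp [dropletSite]⟩

theorem natCast_ne_neg_one {L a : ℕ} (ha : a + 1 < L) : (a : ZMod L) ≠ -1 := by
  intro hc
  have : ((a + 1 : ℕ) : ZMod L) = 0 := by push_cast; rw [hc]; ring
  rw [ZMod.natCast_eq_zero_iff] at this
  exact absurd (Nat.le_of_dvd (Nat.succ_pos a) this) (by omega)

/-- The droplet misses the row and the column just before its corner, so a subset of it contains no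
full line and the planar isoperimetric bound applies. -/
theorem dropletEnergy_le_ising {L : ℕ} [NeZero L] (h2 : 2 < L) {h : ℝ} {x₀ e e' : Site L}
    (he : IsFrame e e') {j : ℕ} (hj : j ≤ (L - 1) * (L - 1)) {t : Config L}
    (ht : ∀ x, t x = 1 → droplet x₀ e e' j x = 1) :
    ising h (allMinus L) + dropletEnergy h (plusCount t) ≤ ising h t := by
  have hcoord : ∀ x, t x = 1 → x.1 ≠ x₀.1 - 1 ∧ x.2 ≠ x₀.2 - 1 := by
    intro x hx
    have := ht x hx
    unfold droplet at this
    split_ifs at this with hc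
    · obtain ⟨i, hi, rfl⟩ := hc
      obtain ⟨a, b, ha, hb, hab⟩ := dropletSite_coord (x₀ := x₀) he (hi.trans_le hj)
      rw [hab, sub_eq_add_neg, sub_eq_add_neg]
      exact ⟨fun h => natCast_ne_neg_one (by omega) (add_left_cancel h),
        fun h => natCast_ne_neg_one (by omega) (add_left_cancel h)⟩
    · exact absurd this (by decide)
  have hA := plusCount_le_of_no_full_line (s := t)
    (fun y => ⟨x₀.1 - 1, ne_one_iff.1 fun hx => (hcoord _ hx).1 rfl⟩)
    (fun x => ⟨x₀.2 - 1, ne_one_iff.1 fun hx => (hcoord _ hx).2 rfl⟩)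
  have hq : (halfPerimeter (plusCount t) : ℝ) ≤ (mixedCols t).card + (mixedRows t).card := by
    exact_mod_cast halfPerimeter_le_add hA
  have := ising_ge_mixed h2 h t
  unfold dropletEnergy
  linarith

/-- There is a chain of configurations from `s` to one of lower energy, of energies below
`ising h s + g`, consecutive ones differing on one sublattice only. -/
def HasDescent {L : ℕ} [NeZero L] (h g : ℝ) (s : Config L) : Prop :=
  ∃ (N : ℕ) (r : ℕ → Config L), r 0 = s ∧
    (∀ j < N, ∃ q : ZMod 2, ∀ x, par x = q → r j x = r (j + 1) x) ∧
    (∀ j ≤ N, ising h (r j) < ising h s + g) ∧ ising h (r N) < ising h s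

theorem exists_par_of_ne {L : ℕ} {s t : Config L} {z : Site L} (hst : ∀ x, x ≠ z → s x = t x) :
    ∃ q : ZMod 2, ∀ x, par x = q → s x = t x :=
  ⟨par z + 1, fun x hx => hst x fun hxz => zmod_two_ne.2 hx (by rw [hxz])⟩

theorem hasDescent_allMinus {L : ℕ} [NeZero L] (hL : Even L) (h2 : 2 < L) {h g : ℝ}
    (h_pos : 0 < h) (h_lt : h < 1) (L_large : 2 * critLength h ≤ L) (hg : activationEnergy h < g) :
    HasDescent h g (allMinus L) := by
  have hsq := Nat.mul_le_mul L_large L_large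
  have he : IsFrame ((1, 0) : Site L) (0, 1) := Or.inl ⟨rfl, rfl⟩
  refine ⟨(2 * critLength h) * (2 * critLength h), droplet 0 (1, 0) (0, 1), droplet_zero _ _ _,
    fun j _ => exists_par_of_ne fun x hx => (droplet_succ_of_ne hx).symm, fun j hj => ?_, ?_⟩
  · have := ising_droplet_le hL h2 (h := h) (x₀ := 0) he (hj.trans hsq)
    linarith [dropletEnergy_le h_pos h_lt j]
  · have := ising_droplet_le hL h2 (h := h) (x₀ := 0) he hsq
    linarith [dropletEnergy_sq_neg h_pos h_lt]

/-- By submodularity, joining the droplet to `s` costs at most the droplet minus its overlap with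
`s`. Starting at a plus next to a minus keeps that overlap nonempty and proper, so it is worth at
least a single plus. -/
theorem hasDescent_of_nonconstant {L : ℕ} [NeZero L] (hL : Even L) (h2 : 2 < L) {h : ℝ}
    (h_pos : 0 < h) (h_lt : h < 1) (L_large : 2 * critLength h ≤ L) {s : Config L} {a b : Site L}
    (ha : s a = 1) (hb : s b = -1) : ∃ g < activationEnergy h, HasDescent h g s := by
  obtain ⟨x₀, e, e', he, hx₀, hx₁⟩ := exists_frame ha hb
  have hΓ := activationEnergy_pos h_pos h_lt
  -- The growth stops at the first droplet cheaper than a single plus; every smaller nonempty one,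
  -- hence every possible overlap, then costs at least `8 - 2 * h`.
  have hN : ∃ j, 1 ≤ j ∧ dropletEnergy h j < 8 - 2 * h := by
    refine ⟨_, ?_, dropletEnergy_sq_lt h_pos h_lt⟩
    have := three_le_critLength h_pos h_lt
    exact Nat.mul_pos (by omega) (by omega)
  classical
  set N := Nat.find hN
  have hN2 : 2 ≤ N := by
    have h1 := Nat.find_spec hN
    rcases h1.1.lt_or_eq with h3 | h3
    · exact h3
    · rw [← h3, dropletEnergy_one] at h1
      exact absurd h1.2 (lt_irrefl _)
  have hNle : N ≤ (L - 1) * (L - 1) :=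
    (Nat.find_min' hN (m := (2 * critLength h - 1) * (2 * critLength h - 1)) ⟨by
      have := three_le_critLength h_pos h_lt
      exact Nat.mul_pos (by omega) (by omega), dropletEnergy_sq_lt h_pos h_lt⟩).trans
      (Nat.mul_le_mul (by omega) (by omega))
  have hNL : N ≤ L * L := hNle.trans (Nat.mul_le_mul (Nat.sub_le _ _) (Nat.sub_le _ _))
  have hmin : ∀ k, 1 ≤ k → k < N → 8 - 2 * h ≤ dropletEnergy h k := fun k h1 hk => by
    by_contra! hc
    exact Nat.find_min hN hk ⟨h1, hc⟩
  have key : ∀ j, 2 ≤ j → j ≤ N → ising h (join s (droplet x₀ e e' j))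
      ≤ ising h s + dropletEnergy h j - (8 - 2 * h) := by
    intro j hj hjN
    set t := meet s (droplet x₀ e e' j) with ht
    have hsub : ∀ x, t x = 1 → droplet x₀ e e' j x = 1 ∧ s x = 1 := fun x hx => by
      simp only [ht, meet] at hx
      split_ifs at hx with hc
      · exact ⟨hc, hx⟩
      · exact absurd hx (by decide)
    have h1 : 1 ≤ plusCount t := by
      refine Finset.card_pos.2 ⟨x₀, ?_⟩
      have : droplet x₀ e e' j x₀ = 1 := by
        conv_lhs => rw [← dropletSite_zero x₀ e e']
        exact if_pos ⟨0, by omega, by simp [dropletSite_zero]⟩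
      simp [ht, meet, this, hx₀]
    -- The droplet site of index 1 is `x₀ + e'`, a minus of `s`, so it is absent from the overlap.
    have hlt : plusCount t < j := by
      have : plusCount t ≤ (((Finset.range j).erase 1).image (dropletSite x₀ e e')).card := by
        refine Finset.card_le_card fun x hx => ?_
        obtain ⟨hd, hsx⟩ := hsub x (Finset.mem_filter.1 hx).2
        unfold droplet at hd
        split_ifs at hd with hc
        · obtain ⟨i, hi, rfl⟩ := hc
          refine Finset.mem_image_of_mem _ (Finset.mem_erase.2 ⟨?_, Finset.mem_range.2 hi⟩)
          rintro rfl
          rw [dropletSite_one, hx₁] at hsx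
          exact absurd hsx (by decide)
        · exact absurd hd (by decide)
      have h3 := this.trans Finset.card_image_le
      rw [Finset.card_erase_of_mem (Finset.mem_range.2 (by omega)), Finset.card_range] at h3
      omega
    have b1 := dropletEnergy_le_ising h2 (h := h) he (hjN.trans hNle) fun x hx => (hsub x hx).1
    have b2 := hmin _ h1 (hlt.trans_le hjN)
    have b3 := ising_join_add_meet h s (droplet x₀ e e' j)
    have b4 := ising_droplet_le hL h2 (h := h) (x₀ := x₀) he (hjN.trans hNL)
    linarith
  have small : ∀ j < 2, join s (droplet x₀ e e' j) = s := by
    intro j hj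
    funext x
    unfold join
    split_ifs with hd
    · unfold droplet at hd
      split_ifs at hd with hc
      · obtain ⟨i, hi, rfl⟩ := hc
        obtain rfl : i = 0 := by omega
        rw [dropletSite_zero, hx₀]
      · exact absurd hd (by decide)
    · rfl
  have hgap : 0 < 8 - 2 * h := by linarith
  -- The first term is positive, for the initial steps that leave `s` unchanged; the second lies
  -- strictly between `activationEnergy h - (8 - 2 * h)` and `activationEnergy h`.
  set g := max (activationEnergy h / 2) (activationEnergy h - (8 - 2 * h) / 2) with hgdef
  have hg1 : activationEnergy h / 2 ≤ g := le_max_left _ _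
  have hg2 : activationEnergy h - (8 - 2 * h) / 2 ≤ g := le_max_right _ _
  refine ⟨g, max_lt (by linarith) (by linarith),
    N, fun j => join s (droplet x₀ e e' j), small 0 (by omega),
    fun j _ => exists_par_of_ne (z := dropletSite x₀ e e' j) fun x hx => by
      simp only [join, droplet_succ_of_ne hx], fun j hj => ?_, ?_⟩
  · rcases lt_or_ge j 2 with h3 | h3
    · simp only [small j h3]; linarith
    · have := key j h3 hj
      have := dropletEnergy_le h_pos h_lt j
      simp only
      linarith
  · have := key N hN2 le_rfl
    have := (Nat.find_spec hN).2
    simp only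
    linarith

/-! ### From chains to paths of the automaton -/

theorem exists_path_of_reflTransGen {α : Type*} {R : α → α → Prop} {a b : α}
    (hab : Relation.ReflTransGen R a b) : ∃ (n : ℕ) (ω : Fin (n + 1) → α), ω 0 = a ∧
      ω (Fin.last n) = b ∧ ∀ i : Fin n, R (ω i.castSucc) (ω i.succ) := by
  induction hab using Relation.ReflTransGen.head_induction_on with
  | refl => exact ⟨0, fun _ => b, rfl, rfl, fun i => i.elim0⟩
  | @head a c hac _ ih =>
    obtain ⟨n, ω, h0, hn, hstep⟩ := ih
    refine ⟨n + 1, Fin.cons a ω, rfl, ?_, fun i => ?_⟩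
    · rw [← Fin.succ_last, Fin.cons_succ, hn]
    · refine Fin.cases ?_ (fun i => ?_) i
      · simpa [h0] using hac
      · rw [← Fin.succ_castSucc, Fin.cons_succ, Fin.cons_succ]
        exact hstep i

theorem stabilityLevel_lt_of_reflTransGen {L : ℕ} [NeZero L] {h g : ℝ} {σ η : Config L}
    (hη : energy h η < energy h σ)
    (hR : Relation.ReflTransGen (fun ξ ζ => commHeight h ξ ζ < energy h σ + g) σ η) :
    stabilityLevel h σ < g := by
  obtain ⟨n, ω, h0, hn, hstep⟩ := exists_path_of_reflTransGen hR
  have hheight : height h n ω < energy h σ + g := by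
    cases n with
    | zero =>
      have : σ = η := by rw [← h0, ← hn]; rfl
      rw [this] at hη
      exact absurd hη (lt_irrefl _)
    | succ n => exact (Finset.sup'_lt_iff ⟨0, Finset.mem_univ _⟩).2 fun i _ => hstep i
  unfold stabilityLevel
  have hle : minimaxSet h σ (lowerSet h σ) ≤ (height h n ω : ℝ) :=
    (iInf₂_le η hη).trans (iInf_le_of_le n (iInf_le_of_le ω (iInf_le_of_le h0 (iInf_le_of_le hn le_rfl))))
  refine lt_of_le_of_lt (EReal.sub_le_sub hle le_rfl) ?_
  rw [← EReal.coe_sub, EReal.coe_lt_coe_iff]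
  linarith

/-- One trajectory of the automaton follows the Ising chain while the other relaxes freely, its half
energy never rising. The total height therefore exceeds `energy h σ` by less than `g`. -/
theorem stabilityLevel_lt_of_hasDescent {L : ℕ} [NeZero L] (hL : Even L) (h2 : 2 < L) {h g : ℝ}
    {p : ZMod 2} {σ : Config L} (hd : HasDescent h g (mix p σ (follow h σ))) :
    stabilityLevel h σ < g := by
  obtain ⟨N, r, h0, hstep, hr, hN⟩ := hd
  change ∀ j ≤ N, ising h (r j) < halfEnergy h p σ + g at hr
  change ising h (r N) < halfEnergy h p σ at hN
  set R : Config L → Config L → Prop := fun ξ ζ => commHeight h ξ ζ < energy h σ + g with hRdef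
  -- One automaton step transfers the tracked configuration `s` from its half on `q` to its half on
  -- `q + 1`, and sets the sublattice `q` to its relaxed value.
  have toggle : ∀ (s ω : Config L) (q : ZMod 2), ising h s < halfEnergy h p σ + g →
      (∀ x, par x = q → ω x = s x) → halfEnergy h (q + 1) ω ≤ halfEnergy h (p + 1) σ →
      ∃ ω', R ω ω' ∧ (∀ x, par x = q + 1 → ω' x = s x) ∧
        halfEnergy h (q + 1 + 1) ω' ≤ halfEnergy h (p + 1) σ := by
    intro s ω q hs hω hle
    have e1 : mix q ω (mix (q + 1) s (follow h ω)) = s := by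
      funext x
      by_cases hx : par x = q
      · simp [mix, hx, hω x hx]
      · simp [mix, zmod_two_ne.1 hx]
    have e2 : mix (q + 1) ω (mix (q + 1) s (follow h ω)) = mix (q + 1) ω (follow h ω) := by
      funext x
      by_cases hx : par x = q + 1 <;> simp [mix, hx]
    refine ⟨mix (q + 1) s (follow h ω), ?_, fun x hx => by simp [mix, hx], ?_⟩
    · rw [hRdef]
      simp only
      rw [commHeight_eq hL h2 h q, energy_eq hL h2 h p σ, e1, e2]
      change ising h s + halfEnergy h (q + 1) ω < _
      linarith
    · refine (halfEnergy_le hL h2 h (q + 1 + 1) _ ω).trans ?_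
      rw [mix_comm, e2]
      exact hle
  have main : ∀ j ≤ N, ∃ (ω : Config L) (q : ZMod 2), Relation.ReflTransGen R σ ω ∧
      (∀ x, par x = q → ω x = r j x) ∧ halfEnergy h (q + 1) ω ≤ halfEnergy h (p + 1) σ := by
    intro j
    induction j with
    | zero =>
      exact fun _ => ⟨σ, p, .refl, fun x hx => by simp [h0, mix, hx], le_rfl⟩
    | succ j ih =>
      intro hj
      obtain ⟨ω, q, hreach, hω, hle⟩ := ih (by omega)
      obtain ⟨q', hq'⟩ := hstep j (by omega)
      -- If the chain changes only the sublattice that is not being tracked, the automaton does not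
      -- move; otherwise one toggle suffices.
      by_cases hqq : q' = q
      · subst hqq
        exact ⟨ω, q', hreach, fun x hx => (hω x hx).trans (hq' x hx), hle⟩
      · obtain ⟨ω', hR, hω', hle'⟩ := toggle (r j) ω q (hr j (by omega)) hω hle
        have : q' = q + 1 := zmod_two_ne.1 hqq
        subst this
        exact ⟨ω', q + 1, hreach.tail hR, fun x hx => (hω' x hx).trans (hq' x hx), hle'⟩
  obtain ⟨ω, q, hreach, hω, hle⟩ := main N le_rfl
  refine stabilityLevel_lt_of_reflTransGen (η := ω) ?_ hreach
  have e : mix q ω (r N) = r N := by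
    funext x
    by_cases hx : par x = q
    · simp [mix, hx, hω x hx]
    · simp [mix, hx]
  have := halfEnergy_le hL h2 h q ω (r N)
  rw [e] at this
  rw [energy_eq hL h2 h q ω, energy_eq hL h2 h p σ]
  linarith

/-! ### Upper bounds on the stability level -/

theorem stabilityLevel_lt_of_half_nonconstant {L : ℕ} [NeZero L] (hL : Even L) (h2 : 2 < L) {h : ℝ}
    (h_pos : 0 < h) (h_lt : h < 1) (L_large : 2 * critLength h ≤ L) {σ : Config L} {a b : Site L}
    (hab : par a = par b) (ha : σ a = 1) (hb : σ b = -1) :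
    stabilityLevel h σ < (activationEnergy h : EReal) := by
  obtain ⟨g, hg, hd⟩ := hasDescent_of_nonconstant hL h2 h_pos h_lt L_large
    (s := mix (par b) σ (follow h σ)) (a := a) (b := b) (by simp [mix, hab, ha])
    (by simp [mix, hb])
  exact (stabilityLevel_lt_of_hasDescent hL h2 hd).trans (EReal.coe_lt_coe_iff.2 hg)

theorem stabilityLevel_le_of_half_minus {L : ℕ} [NeZero L] (hL : Even L) (h2 : 2 < L) {h : ℝ}
    (h_pos : 0 < h) (h_lt : h < 1) (L_large : 2 * critLength h ≤ L) {p : ZMod 2} {σ : Config L}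
    (hm : ∀ x, par x = p → σ x = -1) : stabilityLevel h σ ≤ (activationEnergy h : EReal) := by
  by_contra! hc
  -- Descent needs strict room above the critical droplet, so equality is reached by testing every
  -- `g` above the activation energy.
  obtain ⟨g, hg, hg'⟩ := EReal.lt_iff_exists_real_btwn.1 hc
  have hd := hasDescent_allMinus hL h2 h_pos h_lt L_large (EReal.coe_lt_coe_iff.1 hg)
  rw [← mix_follow_of_minus hL h2 h_lt hm] at hd
  exact (stabilityLevel_lt_of_hasDescent hL h2 hd).not_gt hg'

theorem stabilityLevel_le_of_ne_allPlus {L : ℕ} [NeZero L] (hL : Even L) (h2 : 2 < L) {h : ℝ}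
    (h_pos : 0 < h) (h_lt : h < 1) (L_large : 2 * critLength h ≤ L) {σ : Config L}
    (hσ : σ ≠ allPlus L) : stabilityLevel h σ ≤ (activationEnergy h : EReal) := by
  obtain ⟨b, hb⟩ := Function.ne_iff.1 hσ
  have hb' : σ b = -1 := ne_one_iff.1 hb
  by_cases hp : ∃ a, par a = par b ∧ σ a = 1
  · obtain ⟨a, hab, ha⟩ := hp
    exact (stabilityLevel_lt_of_half_nonconstant hL h2 h_pos h_lt L_large hab ha hb').le
  · push Not at hp
    exact stabilityLevel_le_of_half_minus hL h2 h_pos h_lt L_large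
      fun x hx => ne_one_iff.1 (hp x hx)

/-! ### The ground state and the special configurations -/

theorem groundStates_eq {L : ℕ} [NeZero L] (hL : Even L) (h2 : 2 < L) {h : ℝ} (h_pos : 0 < h) :
    groundStates L h = {allPlus L} := by
  have hu : ∀ p : ZMod 2, halfEnergy h p (allPlus L) = ising h (allPlus L) := fun p =>
    halfEnergy_of_plus hL h2 h_pos fun _ _ => rfl
  ext σ
  simp only [groundStates, Set.mem_ofPred_eq, Set.mem_singleton_iff]
  constructor
  · intro hσ
    by_contra hne
    obtain ⟨x, hx⟩ := Function.ne_iff.1 hne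
    have h1 := hσ (allPlus L)
    rw [energy_eq hL h2 h (par x) σ, energy_eq hL h2 h (par x), hu, hu] at h1
    have h3 : ising h (allPlus L) < halfEnergy h (par x) σ :=
      ising_allPlus_lt_ising h_pos fun hc => hx (by
        have := congrFun hc x
        simpa [mix] using this)
    have h4 : ising h (allPlus L) ≤ halfEnergy h (par x + 1) σ := ising_allPlus_le_ising h_pos _
    linarith
  · rintro rfl η
    rw [energy_eq hL h2 h 0 η, energy_eq hL h2 h 0, hu, hu]
    exact add_le_add (ising_allPlus_le_ising h_pos _) (ising_allPlus_le_ising h_pos _)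

theorem checkerEven_of_par_zero {L : ℕ} {x : Site L} (hx : par x = 0) : checkerEven L x = 1 :=
  ((ZMod.natCast_eq_zero_iff_even).1 hx).neg_one_pow

theorem checkerEven_of_par_one {L : ℕ} {x : Site L} (hx : par x = 1) : checkerEven L x = -1 :=
  ((ZMod.natCast_eq_one_iff_odd).1 hx).neg_one_pow

theorem checkerOdd_of_par_zero {L : ℕ} {x : Site L} (hx : par x = 0) : checkerOdd L x = -1 :=
  ((ZMod.natCast_eq_zero_iff_even).1 hx).add_one.neg_one_pow

theorem checkerOdd_of_par_one {L : ℕ} {x : Site L} (hx : par x = 1) : checkerOdd L x = 1 :=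
  ((ZMod.natCast_eq_one_iff_odd).1 hx).add_one.neg_one_pow

theorem par_eq_zero_or_one {L : ℕ} (x : Site L) : par x = 0 ∨ par x = 1 := by
  generalize par x = a
  revert a; decide

theorem eq_of_par {L : ℕ} {s t : Config L} (h0 : ∀ x, par x = 0 → s x = t x)
    (h1 : ∀ x, par x = 1 → s x = t x) : s = t :=
  funext fun x => (par_eq_zero_or_one x).elim (h0 x) (h1 x)

/-- A configuration that is constant on either sublattice is one of four. -/
theorem eq_of_halves_constant {L : ℕ} {σ : Config L}
    (hσ : ∀ a b : Site L, par a = par b → σ a = 1 → σ b ≠ -1) :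
    σ = allPlus L ∨ σ = allMinus L ∨ σ = checkerEven L ∨ σ = checkerOdd L := by
  have half : ∀ p : ZMod 2, (∀ x, par x = p → σ x = 1) ∨ (∀ x, par x = p → σ x = -1) := by
    intro p
    by_cases hp : ∃ a, par a = p ∧ σ a = 1
    · obtain ⟨a, ha, ha'⟩ := hp
      exact Or.inl fun x hx => by_contra fun hn => hσ a x (ha.trans hx.symm) ha' (ne_one_iff.1 hn)
    · push Not at hp
      exact Or.inr fun x hx => ne_one_iff.1 (hp x hx)
  rcases half 0 with h0 | h0 <;> rcases half 1 with h1 | h1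
  · exact Or.inl (eq_of_par h0 h1)
  · exact Or.inr (Or.inr (Or.inl (eq_of_par
      (fun x hx => (h0 x hx).trans (checkerEven_of_par_zero hx).symm)
      (fun x hx => (h1 x hx).trans (checkerEven_of_par_one hx).symm))))
  · exact Or.inr (Or.inr (Or.inr (eq_of_par
      (fun x hx => (h0 x hx).trans (checkerOdd_of_par_zero hx).symm)
      (fun x hx => (h1 x hx).trans (checkerOdd_of_par_one hx).symm))))
  · exact Or.inr (Or.inl (eq_of_par h0 h1))

theorem allMinus_ne_allPlus {L : ℕ} : allMinus L ≠ allPlus L := fun hc =>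
  absurd (congrFun hc 0) (by unfold allMinus allPlus; decide)

theorem stabilityLevel_allPlus {L : ℕ} [NeZero L] (hL : Even L) (h2 : 2 < L) {h : ℝ}
    (h_pos : 0 < h) : stabilityLevel h (allPlus L) = ⊤ := by
  have hmem : allPlus L ∈ groundStates L h := by rw [groundStates_eq hL h2 h_pos]; rfl
  have : lowerSet h (allPlus L) = ∅ :=
    Set.eq_empty_iff_forall_notMem.2 fun η hη => (hmem η).not_gt hη
  simp [stabilityLevel, minimaxSet, this]

end

end PCA

/-! ### Ground state, metastable states and communication energy -/

theorem mainTheorem3 (L : ℕ) [NeZero L] (h : ℝ) (h_pos : 0 < h) (h_lt : h < 1)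
    (L_even : Even L) (L_large : 2 * PCA.critLength h ≤ L) :
    PCA.groundStates L h = {PCA.allPlus L} ∧
    PCA.metastableStates L h = {PCA.allMinus L, PCA.checkerEven L, PCA.checkerOdd L} ∧
    PCA.energy h (PCA.checkerEven L) = PCA.energy h (PCA.checkerOdd L) ∧
    PCA.energy h (PCA.checkerEven L) < PCA.energy h (PCA.allMinus L) ∧
    0 < PCA.commEnergy L h ∧
    PCA.commEnergy L h = ((PCA.activationEnergy h : ℝ) : EReal) := by
  open PCA in
  have h3 := three_le_critLength h_pos h_lt
  have h2 : 2 < L := by omega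
  have hu := groundStates_eq L_even h2 h_pos
  have hd := le_stabilityLevel_allMinus L_even h2 h_pos h_lt L_large
  have he := le_stabilityLevel_of_half_minus L_even h2 h_pos h_lt L_large
    (σ := checkerEven L) (p := 1) (fun x => checkerEven_of_par_one)
    (fun x hx => checkerEven_of_par_zero hx)
  have ho := le_stabilityLevel_of_half_minus L_even h2 h_pos h_lt L_large
    (σ := checkerOdd L) (p := 0) (fun x => checkerOdd_of_par_zero)
    (fun x hx => checkerOdd_of_par_one hx)
  have hle : ∀ σ, σ ≠ allPlus L → stabilityLevel h σ ≤ (activationEnergy h : EReal) := fun σ hσ =>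
    stabilityLevel_le_of_ne_allPlus L_even h2 h_pos h_lt L_large hσ
  have hE : commEnergy L h = (activationEnergy h : EReal) := by
    unfold commEnergy
    rw [hu]
    exact le_antisymm (iSup₂_le fun σ hσ => hle σ hσ)
      (hd.trans (le_iSup₂_of_le (allMinus L) allMinus_ne_allPlus le_rfl))
  have htop : (activationEnergy h : EReal) ≠ ⊤ := EReal.coe_ne_top _
  have eE : energy h (checkerEven L) = ising h (allPlus L) + ising h (allMinus L) := by
    rw [energy_eq L_even h2 h 0]
    exact congrArg₂ _ (halfEnergy_of_plus L_even h2 h_pos fun x hx => checkerEven_of_par_zero hx)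
      (halfEnergy_of_minus L_even h2 h_lt fun x hx => checkerEven_of_par_one hx)
  have eO : energy h (checkerOdd L) = ising h (allMinus L) + ising h (allPlus L) := by
    rw [energy_eq L_even h2 h 0]
    exact congrArg₂ _ (halfEnergy_of_minus L_even h2 h_lt fun x hx => checkerOdd_of_par_zero hx)
      (halfEnergy_of_plus L_even h2 h_pos fun x hx => checkerOdd_of_par_one hx)
  have eD := energy_allMinus L_even h2 h_lt
  refine ⟨hu, ?_, by rw [eE, eO, add_comm], ?_, ?_, hE⟩
  · ext σ
    simp only [metastableStates, hE, Set.mem_ofPred_eq, Set.mem_insert_iff, Set.mem_singleton_iff]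
    have hne : ∀ ξ, stabilityLevel h ξ = (activationEnergy h : EReal) → ξ ≠ allPlus L := by
      rintro ξ hξ rfl
      rw [stabilityLevel_allPlus L_even h2 h_pos] at hξ
      exact htop hξ.symm
    constructor
    · intro hσ
      refine (eq_of_halves_constant fun a b hab ha hb => ?_).resolve_left (hne σ hσ)
      exact (stabilityLevel_lt_of_half_nonconstant L_even h2 h_pos h_lt L_large hab ha hb).ne hσ
    · rintro (rfl | rfl | rfl)
      · exact le_antisymm (hle _ allMinus_ne_allPlus) hd
      · exact le_antisymm (stabilityLevel_le_of_half_minus L_even h2 h_pos h_lt L_large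
          fun x hx => checkerEven_of_par_one hx) he
      · exact le_antisymm (stabilityLevel_le_of_half_minus L_even h2 h_pos h_lt L_large
          fun x hx => checkerOdd_of_par_zero hx) ho
  · rw [eE, eD]
    have := ising_allPlus_lt_ising h_pos (allMinus_ne_allPlus (L := L))
    linarith
  · rw [hE]
    exact_mod_cast activationEnergy_pos h_pos h_lt
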